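/- Let $F$ be a field of characteristic different from $2$ and $3$. A \emph{pseudo-composition algebra} over $F$ is a commutative (not necessarily associative or unital) $F$-algebra $A$ with a non-zero symmetric bilinear form $(\cdot,\cdot)$ such that $x^3=(x,x)x$ for all $x\in A$. An \emph{axis} is a primitive idempotent, i.e. $e\neq 0$ with $e^2=e$ and $A_1(e)=Fe$, where $A_\mu(e)=\{x\in A: ex=\mu x\}$; then $A=A_1(e)\oplus A_{-1}(e)\oplus A_{1/2}(e)$, and the \emph{Miyamoto involution} $\tau_e$ is the linear map that is the identity on $A_1(e)\oplus A_{-1}(e)$ and $-1$ on $A_{1/2}(e)$. For $\alpha,\beta,\gamma,\psi\in F$, consider pseudo-composition algebras generated by three axes $a,b,c$ with $(a,b)=\alpha$, $(b,c)=\beta$, $(a,c)=\gamma$, $(b,ac)=\psi$. The \emph{universal} algebra with these parameters is such an algebra having every other such algebra (with its three generators) as a homomorphic image, generators being mapped to corresponding generators. In it, let $T=\langle\tau_a,\tau_b,\tau_c\rangle$. For each of the following $(q,\alpha,\beta,\gamma,\psi)$, with $F=\mathbb{F}_q$, the universal algebra exists (it is unique up to isomorphism). (i) $T\cong PSL(3,q)$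 for $(q,\alpha,\beta,\gamma,\psi)=(7,6,2,1,5),\ (11,1,1,3,0),\ (13,8,10,4,2)$. (ii) $T\cong PSU(3,q)$ for $(q,\alpha,\beta,\gamma,\psi)=(7,6,2,1,1),\ (11,1,1,3,1),\ (13,8,10,4,1)$. Here $PSU(3,q)$ is the quotient by its centre of the group of $3\times 3$ matrices $M$ over $\mathbb{F}_{q^2}$ with $\det M=1$ and $M\overline{M}^{\,t}=I$, where the bar raises every entry to the power $q$. -/

import Mathlib

open scoped MatrixGroups

universe u

/-- A commutative (not necessarily associative or unital) `F`-algebra `A` with bilinear form `φ` is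
a pseudo-composition algebra: `φ` is symmetric and non-zero, and `x ^ 3 = φ(x, x) x` for all `x`. -/
structure IsPseudoComposition (F : Type*) {A : Type*} [Field F] [NonUnitalNonAssocCommRing A]
    [Module F A] [IsScalarTower F A A] [SMulCommClass F A A]
    (φ : LinearMap.BilinForm F A) : Prop where
  symm : ∀ x y : A, φ x y = φ y x
  ne_zero : φ ≠ 0
  cube : ∀ x : A, x * (x * x) = φ x x • x

/-- The eigenspace `A_μ(e)` of the multiplication operator `x ↦ e * x`. -/
def axisEigenspace (F : Type*) {A : Type*} [Field F] [NonUnitalNonAssocCommRing A]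
    [Module F A] [IsScalarTower F A A] [SMulCommClass F A A] (e : A) (μ : F) : Submodule F A :=
  Module.End.eigenspace (LinearMap.mulLeft F e) μ

/-- A primitive idempotent: `e ≠ 0`, `e * e = e` and `A_1(e) = F e`. -/
structure IsPrimitiveIdempotent (F : Type*) {A : Type*} [Field F] [NonUnitalNonAssocCommRing A]
    [Module F A] [IsScalarTower F A A] [SMulCommClass F A A] (e : A) : Prop where
  ne_zero : e ≠ 0
  idem : e * e = e
  primitive : axisEigenspace F e 1 = Submodule.span F {e}

/-- `(A, φ)` is a pseudo-composition algebra generated by three primitive idempotents `a, b, c`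
with `φ(a, b) = α`, `φ(b, c) = β`, `φ(a, c) = γ` and `φ(b, ac) = ψ`. -/
structure IsThreeGenerated (F : Type*) {A : Type*} [Field F] [NonUnitalNonAssocCommRing A]
    [Module F A] [IsScalarTower F A A] [SMulCommClass F A A]
    (φ : LinearMap.BilinForm F A) (a b c : A) (α β γ ψ : F) : Prop where
  pseudoComposition : IsPseudoComposition F φ
  axis_a : IsPrimitiveIdempotent F a
  axis_b : IsPrimitiveIdempotent F b
  axis_c : IsPrimitiveIdempotent F c
  generates : NonUnitalAlgebra.adjoin F ({a, b, c} : Set A) = ⊤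
  form_ab : φ a b = α
  form_bc : φ b c = β
  form_ac : φ a c = γ
  form_b_ac : φ b (a * c) = ψ

/-- `(A, φ; a, b, c)` is the universal `3`-generated axial pseudo-composition algebra with
parameters `(α, β, γ, ψ)`: every other one with the same parameters is its homomorphic image, by a
homomorphism that respects the generators. -/
structure IsUniversalThreeGenerated (F : Type*) {A : Type u} [Field F]
    [NonUnitalNonAssocCommRing A] [Module F A] [IsScalarTower F A A] [SMulCommClass F A A]
    (φ : LinearMap.BilinForm F A) (a b c : A) (α β γ ψ : F) : Prop where
  threeGenerated : IsThreeGenerated F φ a b c α β γ ψ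
  universal : ∀ (B : Type u) [NonUnitalNonAssocCommRing B] [Module F B] [IsScalarTower F B B]
    [SMulCommClass F B B] (φ' : LinearMap.BilinForm F B) (a' b' c' : B),
    IsThreeGenerated F φ' a' b' c' α β γ ψ →
      ∃ f : A →ₙₐ[F] B, Function.Surjective f ∧ f a = a' ∧ f b = b' ∧ f c = c'

/-- `τ` is the Miyamoto involution `τ_e`: it is the identity on `A_1(e) ⊕ A_{-1}(e)` and minus the
identity on `A_{1/2}(e)`. -/
def IsMiyamotoInvolution (F : Type*) {A : Type*} [Field F] [NonUnitalNonAssocCommRing A]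
    [Module F A] [IsScalarTower F A A] [SMulCommClass F A A] (e : A) (τ : A ≃ₗ[F] A) : Prop :=
  (∀ x ∈ axisEigenspace F e 1 ⊔ axisEigenspace F e (-1), τ x = x) ∧
    ∀ x ∈ axisEigenspace F e (2⁻¹), τ x = -x

/-- The group `T = ⟨τ_a, τ_b, τ_c⟩`. -/
def miyamotoGroup (F : Type*) {A : Type*} [Field F] [NonUnitalNonAssocCommRing A]
    [Module F A] [IsScalarTower F A A] [SMulCommClass F A A] (a b c : A) :
    Subgroup (A ≃ₗ[F] A) :=
  Subgroup.closure {τ | IsMiyamotoInvolution F a τ ∨ IsMiyamotoInvolution F b τ ∨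
    IsMiyamotoInvolution F c τ}

/-- The universal `3`-generated axial pseudo-composition algebra over `F` with parameters
`(α, β, γ, ψ)` exists, and its group `T = ⟨τ_a, τ_b, τ_c⟩` is isomorphic to `G`. -/
def UniversalMiyamotoGroupIso (F : Type*) [Field F] (α β γ ψ : F) (G : Type*) [Group G] : Prop :=
  (∃ (A : Type u) (_ : NonUnitalNonAssocCommRing A) (_ : Module F A) (_ : IsScalarTower F A A)
    (_ : SMulCommClass F A A) (φ : LinearMap.BilinForm F A) (a b c : A),
    IsUniversalThreeGenerated F φ a b c α β γ ψ) ∧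
  ∀ (A : Type u) [NonUnitalNonAssocCommRing A] [Module F A] [IsScalarTower F A A]
    [SMulCommClass F A A] (φ : LinearMap.BilinForm F A) (a b c : A),
    IsUniversalThreeGenerated F φ a b c α β γ ψ → Nonempty (miyamotoGroup F a b c ≃* G)

/-- Entrywise application of the Frobenius automorphism `x ↦ x ^ p` of `𝔽_{p²}`. -/
noncomputable def frobeniusSL (n p : ℕ) [Fact p.Prime] :
    SL(n, GaloisField p 2) →* SL(n, GaloisField p 2) :=
  Matrix.SpecialLinearGroup.map (frobenius (GaloisField p 2) p)

/-- The special unitary group `SU(n, p)`: matrices `M` over `𝔽_{p²}` with `det M = 1` that preserve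
the standard Hermitian form, `M * (M̄)ᵀ = 1` with `x̄ = x ^ p`. -/
def finiteSU (n p : ℕ) [Fact p.Prime] : Subgroup SL(n, GaloisField p 2) where
  carrier := {M | M * (frobeniusSL n p M).transpose = 1}
  one_mem' := by
    have h : (frobeniusSL n p 1).transpose = 1 := by
      rw [map_one]
      exact Subtype.ext Matrix.transpose_one
    exact (one_mul _).trans h
  mul_mem' := by
    intro M N hM hN
    simp only [Set.mem_ofPred_eq] at hM hN ⊢
    have h : (frobeniusSL n p (M * N)).transpose =
        (frobeniusSL n p N).transpose * (frobeniusSL n p M).transpose := by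
      rw [map_mul]
      exact Subtype.ext (Matrix.transpose_mul _ _)
    rw [h, mul_assoc, ← mul_assoc N, hN, one_mul, hM]
  inv_mem' := by
    intro M hM
    simp only [Set.mem_ofPred_eq] at hM ⊢
    have h : (frobeniusSL n p M).transpose * (frobeniusSL n p M⁻¹).transpose = 1 := by
      have h' : (frobeniusSL n p M⁻¹) * (frobeniusSL n p M) = 1 := by
        rw [← map_mul, inv_mul_cancel, map_one]
      have h2 : ((frobeniusSL n p M⁻¹) * (frobeniusSL n p M)).transpose =
          (frobeniusSL n p M).transpose * (frobeniusSL n p M⁻¹).transpose :=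
        Subtype.ext (Matrix.transpose_mul _ _)
      rw [← h2, h']
      exact Subtype.ext Matrix.transpose_one
    rw [eq_inv_of_mul_eq_one_right hM, inv_mul_eq_one] at h
    rw [← h, inv_mul_cancel]

/-- The projective special unitary group `PSU(n, p) = SU(n, p) / Z(SU(n, p))`. -/
abbrev finitePSU (n p : ℕ) [Fact p.Prime] : Type :=
  finiteSU n p ⧸ Subgroup.center (finiteSU n p)

instance fact_prime_seven : Fact (Nat.Prime 7) := ⟨by norm_num⟩

instance fact_prime_eleven : Fact (Nat.Prime 11) := ⟨by norm_num⟩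

instance fact_prime_thirteen : Fact (Nat.Prime 13) := ⟨by norm_num⟩

/-! Polarising `x³ = (x,x)x` shows that the form associates with the product and that all products
among the eight elements `a, b, c, ab, bc, ac, a(bc), b(ac)` are combinations of these eight, with
coefficients depending only on `α, β, γ, ψ`. Hence these elements span every algebra in question,
and an algebra in which they are linearly independent is universal
(`IsThreeGenerated.exists_surjective_hom`). Conversely, a universal algebra maps isomorphically onto
such a model.

The models consist of traceless `3 × 3` matrices with product `(XY + YX)/2 - tr(XY)/3` and form
`tr(XY)/6`; the cubic identity is Cayley–Hamilton. In case (i) all traceless matrices over `𝔽_q` are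
used. In case (ii) the matrices over `𝔽_{q²}` that are self-adjoint for an isotropic Hermitian form
are used; they form another 8-dimensional `𝔽_q`-algebra. For a rank one projection `p` the element
`3p - 1` is an axis, and its Miyamoto involution is conjugation by the reflection `2p - 1`.

If the three reflections generate `G = SL(3,q)` or `SU(3,q)`, then `T` is the image of `G` acting by
conjugation. An element acts trivially exactly when it fixes the three axes, that is, commutes with
the three reflections, so the kernel is the centre and `T ≅ G/Z(G)`
(`IsThreeGenerated.nonempty_miyamotoGroup_mulEquiv`).

For generation, the first reflection is normalised to be `-J` with `J` the antidiagonal permutation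
matrix. Two explicit words in the reflections are unitriangular and do not commute; they yield the
whole unitriangular subgroup, conjugation by `-J` yields the lower one, and elimination does the
rest. What remains for each `q` is a finite computation. -/

namespace IsPseudoComposition

/-! ### Polarised forms of the cubic identity. -/

variable {F A : Type*} [Field F] [NonUnitalNonAssocCommRing A] [Module F A] [IsScalarTower F A A]
  [SMulCommClass F A A] {φ : LinearMap.BilinForm F A}

theorem trilinear (h : IsPseudoComposition F φ) (h2 : (2 : F) ≠ 0) (x y z : A) :
    x * (y * z) + y * (x * z) + z * (x * y) = φ x y • z + φ y z • x + φ x z • y := by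
  have e0 := h.cube (x + y + z)
  have e1 := h.cube (x + y)
  have e2 := h.cube (y + z)
  have e3 := h.cube (x + z)
  have e4 := h.cube x
  have e5 := h.cube y
  have e6 := h.cube z
  simp only [mul_add, add_mul, map_add, LinearMap.add_apply, mul_comm y x, mul_comm z x,
    mul_comm z y, h.symm y x, h.symm z x, h.symm z y] at e0 e1 e2 e3 e4 e5 e6
  refine smul_right_injective A h2 ?_
  linear_combination (norm := module) e0 - e1 - e2 - e3 + e4 + e5 + e6

theorem mul_mul_self_add (h : IsPseudoComposition F φ) (h2 : (2 : F) ≠ 0) (x y : A) :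
    (2 : F) • (x * (x * y)) + y * (x * x) = (2 * φ x y) • x + φ x x • y := by
  have e := h.trilinear h2 x x y
  linear_combination (norm := module) e

/-- The linearisation of the identity for `(x * x) * (x * x)`. -/
theorem quadrilinear (h : IsPseudoComposition F φ) (h2 : (2 : F) ≠ 0) (x y z w : A) :
    (2 : F) • ((x * y) * (z * w) + (x * z) * (y * w) + (x * w) * (y * z)) =
      (φ y (z * w) + φ z (y * w) + φ w (y * z)) • x + (φ x (z * w) + φ z (x * w) + φ w (x * z)) • y
      + (φ x (y * w) + φ y (x * w) + φ w (x * y)) • z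
      + (φ x (y * z) + φ y (x * z) + φ z (x * y)) • w
      - (φ x y • (z * w) + φ z w • (x * y) + φ x z • (y * w) + φ y w • (x * z) + φ x w • (y * z)
        + φ y z • (x * w)) := by
  -- Each `(xy)(zw)` occurs in two of these six instances. The twelve nested products such as
  -- `x(y(zw))` are removed by the trilinear identity in three variables multiplied by the fourth.
  have e1 := h.trilinear h2 x y (z * w)
  have e2 := h.trilinear h2 z w (x * y)
  have e3 := h.trilinear h2 x z (y * w)
  have e4 := h.trilinear h2 y w (x * z)
  have e5 := h.trilinear h2 x w (y * z)
  have e6 := h.trilinear h2 y z (x * w)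
  have f1 := congrArg (x * ·) (h.trilinear h2 y z w)
  have f2 := congrArg (y * ·) (h.trilinear h2 x z w)
  have f3 := congrArg (z * ·) (h.trilinear h2 x y w)
  have f4 := congrArg (w * ·) (h.trilinear h2 x y z)
  simp only [mul_add, mul_smul_comm, mul_comm y x, mul_comm z x, mul_comm w x,
    mul_comm z y, mul_comm w y, mul_comm w z] at f1 f2 f3 f4
  rw [mul_comm (z * w) (x * y)] at e1
  rw [mul_comm (y * w) (x * z)] at e3
  rw [mul_comm (y * z) (x * w), mul_comm (x * w) (y * z)] at *
  linear_combination (norm := module) e1 + e2 + e3 + e4 + e5 + e6 - f1 - f2 - f3 - f4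

end IsPseudoComposition

/-! ### Associativity of the form. -/

namespace IsPseudoComposition

variable {F A : Type*} [Field F] [NonUnitalNonAssocCommRing A] [Module F A] [IsScalarTower F A A]
  [SMulCommClass F A A] {φ : LinearMap.BilinForm F A}

theorem mul_self_mul_mul_self (h : IsPseudoComposition F φ) (h2 : (2 : F) ≠ 0) (x : A) :
    (x * x) * (x * x) = (2 * φ x (x * x)) • x - φ x x • (x * x) := by
  have e := h.mul_mul_self_add h2 x (x * x)
  rw [h.cube, mul_smul_comm] at e
  linear_combination (norm := module) e

theorem mul_self_mul_mul (h : IsPseudoComposition F φ) (h2 : (2 : F) ≠ 0) (h3 : (3 : F) ≠ 0)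
    (x z : A) :
    (2 : F) • ((x * x) * (x * z)) = (φ z (x * x) + 2 * φ x (x * z)) • x + φ x (x * x) • z
      - φ x x • (x * z) - φ x z • (x * x) := by
  have e := h.quadrilinear h2 x x x z
  rw [mul_comm (x * z) (x * x)] at e
  refine smul_right_injective A h3 ?_
  linear_combination (norm := module) e

/-- The degenerate case of `form_self_mul`, where `x` and `x²` are dependent: `x(x(xy))` is computed
in two ways and the coefficients of `x` are compared. -/
theorem form_mul_self_of_mul_self_eq_smul (h : IsPseudoComposition F φ) (h2 : (2 : F) ≠ 0)
    {x : A} {t : F} (hx : x * x = t • x) (y : A) : φ x (x * y) = φ (x * x) y := by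
  by_cases hx0 : x = 0
  · simp [hx0]
  have e1 := h.mul_mul_self_add h2 x y
  have e2 := h.mul_mul_self_add h2 x (x * y)
  have e3 := congrArg (x * ·) e1
  have ht : φ x x = t ^ 2 := by
    have e := h.cube x
    rw [hx, mul_smul_comm, hx, smul_smul] at e
    rw [sq]
    exact (smul_left_injective F hx0 e).symm
  simp only [hx, mul_add, mul_smul_comm, ht, mul_comm y x, mul_comm (x * y) x] at e1 e2 e3
  have e4 : (2 * φ x (x * y)) • x = (2 * (t * φ x y)) • x := by
    linear_combination (norm := module) e3 - e2
  rw [hx, map_smul, LinearMap.smul_apply, smul_eq_mul]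
  exact mul_left_cancel₀ h2 (smul_left_injective F hx0 e4)

/-- Associativity of the form is not an axiom but a consequence of the cubic identity. Evaluating
`x²(x²y)` with the two-variable and four-variable identities puts a multiple of `x²` by `2(φ(x, xy)
- φ(x², y))` into `Fx`. Unless `x² ∈ Fx`, this factor has to vanish. -/
theorem form_self_mul (h : IsPseudoComposition F φ) (h2 : (2 : F) ≠ 0) (h3 : (3 : F) ≠ 0)
    (x y : A) : φ x (x * y) = φ (x * x) y := by
  by_cases hx : ∃ t : F, x * x = t • x
  · obtain ⟨t, ht⟩ := hx
    exact h.form_mul_self_of_mul_self_eq_smul h2 ht y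
  -- The cubic identity at `x²`, with `x²x²` already known to lie in the span of `x` and `x²`.
  have hxx : φ (x * x) (x * x) = φ x x ^ 2 := by
    have e1 := h.cube (x * x)
    rw [h.mul_self_mul_mul_self h2, mul_sub, mul_smul_comm, mul_smul_comm, mul_comm (x * x) x,
      h.cube, h.mul_self_mul_mul_self h2] at e1
    have e2 : (φ x x ^ 2) • (x * x) = φ (x * x) (x * x) • (x * x) := by
      linear_combination (norm := module) e1
    refine (smul_left_injective F (fun h0 => hx ⟨0, ?_⟩) e2).symm
    rw [h0, zero_smul]
  have e1 := h.mul_mul_self_add h2 (x * x) y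
  have e2 := congrArg ((x * x) * ·) (h.mul_mul_self_add h2 x y)
  have e3 := h.mul_self_mul_mul h2 h3 x (x * y)
  have e4 := h.mul_mul_self_add h2 x y
  rw [h.mul_self_mul_mul_self h2, hxx] at e1
  simp only [mul_add, mul_sub, mul_smul_comm, mul_comm (x * x) x, h.cube, mul_comm y (x * x),
    mul_comm y x] at e1 e2 e4
  have key : (2 * (φ x (x * y) - φ (x * x) y)) • (x * x) =
      (2 * φ (x * y) (x * x) + 4 * φ x (x * (x * y)) - 6 * (φ x x * φ x y)) • x := by
    linear_combination (norm := module) e1 - (2 : F) • e2 + (2 : F) • e3 - (φ x x) • e4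
  by_contra hne
  have hd : 2 * (φ x (x * y) - φ (x * x) y) ≠ 0 := mul_ne_zero h2 (sub_ne_zero.2 hne)
  refine hx ⟨(2 * (φ x (x * y) - φ (x * x) y))⁻¹ *
    (2 * φ (x * y) (x * x) + 4 * φ x (x * (x * y)) - 6 * (φ x x * φ x y)), ?_⟩
  rw [mul_smul, ← key, inv_smul_smul₀ hd]

/-- Polarising `form_self_mul` in `x` gives a relation among the three values of the form on `x, y,
z`; two of its permutations determine them up to the factor `3`. -/
theorem form_assoc (h : IsPseudoComposition F φ) (h2 : (2 : F) ≠ 0) (h3 : (3 : F) ≠ 0)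
    (x y z : A) : φ (x * y) z = φ x (y * z) := by
  have e (x y z : A) : φ x (z * y) + φ z (x * y) = 2 * φ (x * z) y := by
    have e0 := h.form_self_mul h2 h3 (x + z) y
    have e1 := h.form_self_mul h2 h3 x y
    have e2 := h.form_self_mul h2 h3 z y
    simp only [mul_add, add_mul, map_add, LinearMap.add_apply, mul_comm z x] at e0
    linear_combination e0 - e1 - e2
  have e1 := e x z y
  have e2 := e x y z
  rw [h.symm z (x * y), mul_comm z y, h.symm (x * z) y] at e2
  refine mul_left_cancel₀ h3 ?_
  linear_combination -2 * e1 - e2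

theorem form_mul_left_comm (h : IsPseudoComposition F φ) (h2 : (2 : F) ≠ 0) (h3 : (3 : F) ≠ 0)
    (x y z : A) : φ x (y * z) = φ y (x * z) := by
  rw [← h.form_assoc h2 h3, mul_comm, h.form_assoc h2 h3]

/-! ### Idempotents and their Miyamoto involutions. -/

section Idempotent

variable {e : A}

theorem form_idem (h : IsPseudoComposition F φ) (he0 : e ≠ 0) (he : e * e = e) : φ e e = 1 := by
  have e1 := h.cube e
  rw [he, he] at e1
  exact (smul_left_injective F he0 (by simpa using e1)).symm

theorem form_idem_mul (h : IsPseudoComposition F φ) (h2 : (2 : F) ≠ 0) (h3 : (3 : F) ≠ 0)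
    (he : e * e = e) (x : A) : φ e (e * x) = φ e x := by
  rw [h.form_self_mul h2 h3, he]

theorem idem_mul_mul (h : IsPseudoComposition F φ) (h2 : (2 : F) ≠ 0) (he0 : e ≠ 0)
    (he : e * e = e) (x : A) :
    e * (e * x) = (1 / 2 : F) • x - (1 / 2 : F) • (e * x) + φ e x • e := by
  have e1 := h.mul_mul_self_add h2 e x
  rw [he, mul_comm x e, h.form_idem he0 he] at e1
  refine smul_right_injective A h2 ?_
  linear_combination (norm := skip) e1
  match_scalars <;> field_simp <;> ring

/-- The four-variable identity with two arguments equal to `e`. Most of the multiplication table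
below consists of instances of it. -/
theorem idem_mul_mul_idem_mul (h : IsPseudoComposition F φ) (h2 : (2 : F) ≠ 0) (h3 : (3 : F) ≠ 0)
    (he0 : e ≠ 0) (he : e * e = e) (x y : A) :
    (e * x) * (e * y) = -((1 / 2 : F) • (e * (x * y))) - (1 / 4 : F) • (x * y)
      + (3 / 2 * φ e (x * y) - 1 / 4 * φ x y) • e - (1 / 2 * φ e x) • (e * y)
      - (1 / 2 * φ e y) • (e * x) + (3 / 4 * φ e y) • x + (3 / 4 * φ e x) • y := by
  have h4 : (4 : F) ≠ 0 := by
    rw [show (4 : F) = 2 * 2 by norm_num]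
    exact mul_ne_zero h2 h2
  have e1 := h.quadrilinear h2 e e x y
  simp only [h.form_mul_left_comm h2 h3 x e, h.form_mul_left_comm h2 h3 y e,
    h.form_idem_mul h2 h3 he, he, h.form_idem he0 he, mul_comm (e * y) (e * x),
    h.symm x e, h.symm y e, mul_comm y x] at e1
  refine smul_right_injective A h4 ?_
  linear_combination (norm := skip) e1
  match_scalars <;> field_simp <;> ring

/-- Primitivity is automatic: if `ex = x`, the two-variable identity collapses to `x = φ(e,x)e`. -/
theorem isPrimitiveIdempotent (h : IsPseudoComposition F φ) (h2 : (2 : F) ≠ 0)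
    (he0 : e ≠ 0) (he : e * e = e) : IsPrimitiveIdempotent F e := by
  refine ⟨he0, he, le_antisymm (fun x hx => ?_) ?_⟩
  · have hx' : e * x = x := by
      simpa [axisEigenspace, Module.End.mem_eigenspace_iff] using hx
    have e1 := h.mul_mul_self_add h2 e x
    rw [he, mul_comm x e, h.form_idem he0 he, hx', hx'] at e1
    refine Submodule.mem_span_singleton.2 ⟨φ e x, smul_right_injective A h2 ?_⟩
    linear_combination (norm := module) -e1
  · rw [Submodule.span_singleton_le_iff_mem]
    simp [axisEigenspace, he]

/-- The Miyamoto involution of an idempotent is given by a quadratic formula. -/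
theorem miyamotoInvolution_apply (h : IsPseudoComposition F φ) (h2 : (2 : F) ≠ 0)
    (he0 : e ≠ 0) (he : e * e = e) {τ : A ≃ₗ[F] A}
    (hτ : IsMiyamotoInvolution F e τ) (x : A) :
    (3 : F) • τ x = (8 * φ e x) • e - (4 : F) • (e * x) - x := by
  have hm (μ : F) (y : A) : y ∈ axisEigenspace F e μ ↔ e * y = μ • y := by
    simp [axisEigenspace]
  have k1 := hτ.1 e (Submodule.mem_sup_left ((hm 1 e).2 (by simp [he])))
  have hxx := h.idem_mul_mul h2 he0 he x
  -- Here `x = φ(e,x)e + y/3 + 2z/3` with `y = x - 2ex + φ(e,x)e` in `A_{-1}(e)` and `z = x + ex -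
  -- 2φ(e,x)e` in `A_{1/2}(e)`.
  have k2 := hτ.1 (x - (2 : F) • (e * x) + φ e x • e) (Submodule.mem_sup_right ((hm _ _).2 (by
    simp only [mul_add, mul_sub, mul_smul_comm, hxx, he]
    match_scalars <;> field_simp <;> ring)))
  have k3 := hτ.2 (x + e * x - (2 * φ e x) • e) ((hm _ _).2 (by
    simp only [mul_add, mul_sub, mul_smul_comm, hxx, he]
    match_scalars <;> field_simp <;> ring))
  simp only [map_add, map_sub, map_smul, k1] at k2 k3
  linear_combination (norm := module) k2 + (2 : F) • k3

theorem isMiyamotoInvolution_of_apply (h : IsPseudoComposition F φ) (h2 : (2 : F) ≠ 0)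
    (h3 : (3 : F) ≠ 0) (he0 : e ≠ 0) (he : e * e = e) {τ : A ≃ₗ[F] A}
    (hτ : ∀ x, (3 : F) • τ x = (8 * φ e x) • e - (4 : F) • (e * x) - x) :
    IsMiyamotoInvolution F e τ := by
  have hm (μ : F) (y : A) : y ∈ axisEigenspace F e μ ↔ e * y = μ • y := by
    simp [axisEigenspace]
  refine ⟨fun x hx => ?_, fun x hx => ?_⟩
  · obtain ⟨y, hy, z, hz, rfl⟩ := Submodule.mem_sup.1 hx
    rw [(h.isPrimitiveIdempotent h2 he0 he).primitive, Submodule.mem_span_singleton] at hy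
    obtain ⟨t, rfl⟩ := hy
    rw [hm] at hz
    -- Since `φ(e, ez) = φ(e, z)`, the form with `e` vanishes on every eigenvector of eigenvalue
    -- other than `1`.
    have h0 := h.form_idem_mul h2 h3 he z
    rw [hz, map_smul, smul_eq_mul] at h0
    have h0' : φ e z = 0 := by
      refine (mul_eq_zero.1 (?_ : 2 * φ e z = 0)).resolve_left h2
      linear_combination -h0
    have e1 := hτ (t • e + z)
    simp only [map_add, map_smul, mul_add, mul_smul_comm, he, hz, h0', h.form_idem he0 he] at e1
    refine smul_right_injective A h3 ?_
    simp only [map_add, map_smul, smul_eq_mul] at e1 ⊢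
    linear_combination (norm := module) e1
  · rw [hm] at hx
    have h0 := h.form_idem_mul h2 h3 he x
    rw [hx, map_smul, smul_eq_mul] at h0
    have h0' : φ e x = 0 := by
      have : (2 : F)⁻¹ * 2 = 1 := inv_mul_cancel₀ h2
      linear_combination -2 * h0 + φ e x * this
    have e1 := hτ x
    rw [h0', hx] at e1
    refine smul_right_injective A h3 ?_
    linear_combination (norm := skip) e1
    match_scalars <;> field_simp <;> ring

end Idempotent

end IsPseudoComposition

theorem four_eight_sixteen_ne_zero {F : Type*} [Field F] (h2 : (2 : F) ≠ 0) :
    (4 : F) ≠ 0 ∧ (8 : F) ≠ 0 ∧ (16 : F) ≠ 0 := by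
  rw [show (4 : F) = 2 ^ 2 by norm_num, show (8 : F) = 2 ^ 3 by norm_num,
    show (16 : F) = 2 ^ 4 by norm_num]
  exact ⟨pow_ne_zero _ h2, pow_ne_zero _ h2, pow_ne_zero _ h2⟩

/-! ### The multiplication table on eight products of three axes. -/

namespace IsThreeGenerated

variable {F A : Type*} [Field F] [NonUnitalNonAssocCommRing A] [Module F A] [IsScalarTower F A A]
  [SMulCommClass F A A] {φ : LinearMap.BilinForm F A} {a b c : A} {α β γ ψ : F}

section Form

variable (H : IsThreeGenerated F φ a b c α β γ ψ)
include H

theorem form_bb : φ b b = 1 := H.pseudoComposition.form_idem H.axis_b.ne_zero H.axis_b.idem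

theorem form_cc : φ c c = 1 := H.pseudoComposition.form_idem H.axis_c.ne_zero H.axis_c.idem

theorem form_ba : φ b a = α := by rw [H.pseudoComposition.symm, H.form_ab]

theorem form_cb : φ c b = β := by rw [H.pseudoComposition.symm, H.form_bc]

theorem form_ca : φ c a = γ := by rw [H.pseudoComposition.symm, H.form_ac]

variable (h2 : (2 : F) ≠ 0) (h3 : (3 : F) ≠ 0)
include h2 h3

theorem form_b_ab : φ b (a * b) = α := by
  rw [mul_comm a b, H.pseudoComposition.form_idem_mul h2 h3 H.axis_b.idem, H.form_ba]

theorem form_b_bc : φ b (b * c) = β := by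
  rw [H.pseudoComposition.form_idem_mul h2 h3 H.axis_b.idem, H.form_bc]

theorem form_c_bc : φ c (b * c) = β := by
  rw [mul_comm b c, H.pseudoComposition.form_idem_mul h2 h3 H.axis_c.idem, H.form_cb]

theorem form_a_ac : φ a (a * c) = γ := by
  rw [H.pseudoComposition.form_idem_mul h2 h3 H.axis_a.idem, H.form_ac]

theorem form_c_ac : φ c (a * c) = γ := by
  rw [mul_comm a c, H.pseudoComposition.form_idem_mul h2 h3 H.axis_c.idem, H.form_ca]

theorem form_a_bc : φ a (b * c) = ψ := by
  rw [H.pseudoComposition.form_mul_left_comm h2 h3, H.form_b_ac]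

theorem form_c_ab : φ c (a * b) = ψ := by
  rw [H.pseudoComposition.form_mul_left_comm h2 h3, mul_comm, H.form_a_bc h2 h3]

end Form

section Product

variable (H : IsThreeGenerated F φ a b c α β γ ψ) (h2 : (2 : F) ≠ 0) (h3 : (3 : F) ≠ 0)
include H h2 h3

omit h3 in
theorem mul_a_ab : a * (a * b) =
    α • a +
      (1 / 2 : F) • b +
      (-1 / 2 : F) • (a * b) := by
  have e := H.pseudoComposition.idem_mul_mul h2 H.axis_a.ne_zero H.axis_a.idem b
  simp only [H.form_ab] at e
  linear_combination (norm := skip) e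
  match_scalars <;> field_simp <;> ring

omit h3 in
theorem mul_b_ab : b * (a * b) =
    (1 / 2 : F) • a +
      α • b +
      (-1 / 2 : F) • (a * b) := by
  have e := H.pseudoComposition.idem_mul_mul h2 H.axis_b.ne_zero H.axis_b.idem a
  simp only [mul_comm b a, H.form_ba] at e
  linear_combination (norm := skip) e
  match_scalars <;> field_simp <;> ring

omit h3 in
theorem mul_b_bc : b * (b * c) =
    β • b +
      (1 / 2 : F) • c +
      (-1 / 2 : F) • (b * c) := by
  have e := H.pseudoComposition.idem_mul_mul h2 H.axis_b.ne_zero H.axis_b.idem c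
  simp only [H.form_bc] at e
  linear_combination (norm := skip) e
  match_scalars <;> field_simp <;> ring

omit h3 in
theorem mul_c_bc : c * (b * c) =
    (1 / 2 : F) • b +
      β • c +
      (-1 / 2 : F) • (b * c) := by
  have e := H.pseudoComposition.idem_mul_mul h2 H.axis_c.ne_zero H.axis_c.idem b
  simp only [mul_comm c b, H.form_cb] at e
  linear_combination (norm := skip) e
  match_scalars <;> field_simp <;> ring

omit h3 in
theorem mul_a_ac : a * (a * c) =
    γ • a +
      (1 / 2 : F) • c +
      (-1 / 2 : F) • (a * c) := by
  have e := H.pseudoComposition.idem_mul_mul h2 H.axis_a.ne_zero H.axis_a.idem c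
  simp only [H.form_ac] at e
  linear_combination (norm := skip) e
  match_scalars <;> field_simp <;> ring

omit h3 in
theorem mul_c_ac : c * (a * c) =
    (1 / 2 : F) • a +
      γ • c +
      (-1 / 2 : F) • (a * c) := by
  have e := H.pseudoComposition.idem_mul_mul h2 H.axis_c.ne_zero H.axis_c.idem a
  simp only [mul_comm c a, H.form_ca] at e
  linear_combination (norm := skip) e
  match_scalars <;> field_simp <;> ring

theorem mul_a_abc : a * (a * (b * c)) =
    ψ • a +
      (1 / 2 : F) • (b * c) +
      (-1 / 2 : F) • (a * (b * c)) := by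
  have e := H.pseudoComposition.idem_mul_mul h2 H.axis_a.ne_zero H.axis_a.idem (b * c)
  simp only [H.form_a_bc h2 h3] at e
  linear_combination (norm := skip) e
  match_scalars <;> field_simp <;> ring

omit h3 in
theorem mul_b_bac : b * (b * (a * c)) =
    ψ • b +
      (1 / 2 : F) • (a * c) +
      (-1 / 2 : F) • (b * (a * c)) := by
  have e := H.pseudoComposition.idem_mul_mul h2 H.axis_b.ne_zero H.axis_b.idem (a * c)
  simp only [H.form_b_ac] at e
  linear_combination (norm := skip) e
  match_scalars <;> field_simp <;> ring

omit h3 in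
-- The trilinear identity makes one of `a(bc)`, `b(ac)`, `c(ab)` redundant. Dropping `c(ab)` is a
-- choice, and it breaks the symmetry of the table in `a, b, c`.
theorem mul_c_ab : c * (a * b) =
    β • a +
      γ • b +
      α • c +
      (-1 : F) • (a * (b * c)) +
      (-1 : F) • (b * (a * c)) := by
  obtain ⟨h4, h8, h16⟩ := four_eight_sixteen_ne_zero h2
  have e := H.pseudoComposition.trilinear h2 c a b
  simp only [mul_comm c a, mul_comm c b, H.form_ab, H.form_cb, H.form_ca] at e
  linear_combination (norm := skip) e
  match_scalars <;> field_simp <;> ring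

theorem mul_ab_ac : (a * b) * (a * c) =
    (-1 / 4 * β + 3 / 2 * ψ) • a +
      (3 / 4 * γ) • b +
      (3 / 4 * α) • c +
      (-1 / 2 * γ) • (a * b) +
      (-1 / 4 : F) • (b * c) +
      (-1 / 2 * α) • (a * c) +
      (-1 / 2 : F) • (a * (b * c)) := by
  obtain ⟨h4, h8, h16⟩ := four_eight_sixteen_ne_zero h2
  have e := H.pseudoComposition.idem_mul_mul_idem_mul h2 h3 H.axis_a.ne_zero H.axis_a.idem b c
  simp only [H.form_ab, H.form_bc, H.form_ac, H.form_a_bc h2 h3] at e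
  linear_combination (norm := skip) e
  match_scalars <;> field_simp <;> ring

theorem mul_ab_bc : (a * b) * (b * c) =
    (3 / 4 * β) • a +
      (-1 / 4 * γ + 3 / 2 * ψ) • b +
      (3 / 4 * α) • c +
      (-1 / 2 * β) • (a * b) +
      (-1 / 2 * α) • (b * c) +
      (-1 / 4 : F) • (a * c) +
      (-1 / 2 : F) • (b * (a * c)) := by
  obtain ⟨h4, h8, h16⟩ := four_eight_sixteen_ne_zero h2
  have e := H.pseudoComposition.idem_mul_mul_idem_mul h2 h3 H.axis_b.ne_zero H.axis_b.idem a c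
  simp only [mul_comm b a, H.form_bc, H.form_ac, H.form_b_ac, H.form_ba] at e
  linear_combination (norm := skip) e
  match_scalars <;> field_simp <;> ring

theorem mul_bc_ac : (b * c) * (a * c) =
    (1 / 4 * β) • a +
      (1 / 4 * γ) • b +
      (-3 / 4 * α + 3 / 2 * ψ) • c +
      (-1 / 4 : F) • (a * b) +
      (-1 / 2 * γ) • (b * c) +
      (-1 / 2 * β) • (a * c) +
      (1 / 2 : F) • (a * (b * c)) +
      (1 / 2 : F) • (b * (a * c)) := by
  obtain ⟨h4, h8, h16⟩ := four_eight_sixteen_ne_zero h2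
  have e := H.pseudoComposition.idem_mul_mul_idem_mul h2 h3 H.axis_c.ne_zero H.axis_c.idem a b
  simp only [smul_add, mul_comm c a, mul_comm c b, mul_comm (a * c) (b * c), H.form_ab, H.form_cb,
    H.form_ca, H.form_c_ab h2 h3, H.mul_c_ab h2] at e
  linear_combination (norm := skip) e
  match_scalars <;> field_simp <;> ring

theorem mul_ab_ab : (a * b) * (a * b) =
    (3 / 2 * α - 1 / 4) • a +
      (3 / 2 * α - 1 / 4) • b +
      (-α - 1 / 2) • (a * b) := by
  obtain ⟨h4, h8, h16⟩ := four_eight_sixteen_ne_zero h2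
  have e := H.pseudoComposition.idem_mul_mul_idem_mul h2 h3 H.axis_a.ne_zero H.axis_a.idem b b
  simp only [H.axis_b.idem, H.form_bb, H.form_ab] at e
  linear_combination (norm := skip) e
  match_scalars <;> field_simp <;> ring

theorem mul_bc_bc : (b * c) * (b * c) =
    (3 / 2 * β - 1 / 4) • b +
      (3 / 2 * β - 1 / 4) • c +
      (-β - 1 / 2) • (b * c) := by
  obtain ⟨h4, h8, h16⟩ := four_eight_sixteen_ne_zero h2
  have e := H.pseudoComposition.idem_mul_mul_idem_mul h2 h3 H.axis_b.ne_zero H.axis_b.idem c c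
  simp only [H.axis_c.idem, H.form_cc, H.form_bc] at e
  linear_combination (norm := skip) e
  match_scalars <;> field_simp <;> ring

theorem mul_ac_ac : (a * c) * (a * c) =
    (3 / 2 * γ - 1 / 4) • a +
      (3 / 2 * γ - 1 / 4) • c +
      (-γ - 1 / 2) • (a * c) := by
  obtain ⟨h4, h8, h16⟩ := four_eight_sixteen_ne_zero h2
  have e := H.pseudoComposition.idem_mul_mul_idem_mul h2 h3 H.axis_a.ne_zero H.axis_a.idem c c
  simp only [H.axis_c.idem, H.form_cc, H.form_ac] at e
  linear_combination (norm := skip) e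
  match_scalars <;> field_simp <;> ring

/-- In the trilinear identity for `b, a, bc` the other two terms `a(b(bc))` and `(bc)(ab)` are
already in the table. The next three lemmas follow the same pattern. -/
theorem mul_b_abc : b * (a * (b * c)) =
    (1 / 4 * β) • a +
      (1 / 4 * γ - 1 / 2 * ψ) • b +
      (-3 / 4 * α) • c +
      (-1 / 2 * β) • (a * b) +
      (3 / 2 * α) • (b * c) +
      (-1 / 4 : F) • (a * c) +
      (1 / 2 : F) • (a * (b * c)) +
      (1 / 2 : F) • (b * (a * c)) := by
  obtain ⟨h4, h8, h16⟩ := four_eight_sixteen_ne_zero h2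
  have e := H.pseudoComposition.trilinear h2 b a (b * c)
  simp only [mul_add, mul_smul_comm, mul_comm b a, mul_comm (b * c) (a * b), H.form_ba,
    H.form_b_bc h2 h3, H.form_a_bc h2 h3, H.mul_b_bc h2, H.mul_ab_bc h2 h3] at e
  linear_combination (norm := skip) e
  match_scalars <;> field_simp <;> ring

theorem mul_c_abc : c * (a * (b * c)) =
    (3 / 4 * β) • a +
      (-1 / 4 * γ) • b +
      (3 / 4 * α - 1 / 2 * ψ) • c +
      (-1 / 4 : F) • (a * b) +
      (3 / 2 * γ) • (b * c) +
      (-1 / 2 * β) • (a * c) +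
      (-1 / 2 : F) • (b * (a * c)) := by
  obtain ⟨h4, h8, h16⟩ := four_eight_sixteen_ne_zero h2
  have e := H.pseudoComposition.trilinear h2 c a (b * c)
  simp only [mul_add, mul_smul_comm, mul_comm c a, H.form_ca, H.form_c_bc h2 h3, H.form_a_bc h2 h3,
    H.mul_c_bc h2, H.mul_bc_ac h2 h3] at e
  linear_combination (norm := skip) e
  match_scalars <;> field_simp <;> ring

theorem mul_a_bac : a * (b * (a * c)) =
    (1 / 4 * β - 1 / 2 * ψ) • a +
      (1 / 4 * γ) • b +
      (-3 / 4 * α) • c +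
      (-1 / 2 * γ) • (a * b) +
      (-1 / 4 : F) • (b * c) +
      (3 / 2 * α) • (a * c) +
      (1 / 2 : F) • (a * (b * c)) +
      (1 / 2 : F) • (b * (a * c)) := by
  obtain ⟨h4, h8, h16⟩ := four_eight_sixteen_ne_zero h2
  have e := H.pseudoComposition.trilinear h2 a b (a * c)
  simp only [mul_add, mul_smul_comm, mul_comm b a, mul_comm (a * c) (a * b), H.form_ab, H.form_b_ac,
    H.form_a_ac h2 h3, H.mul_a_ac h2, H.mul_ab_ac h2 h3] at e
  linear_combination (norm := skip) e
  match_scalars <;> field_simp <;> ring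

theorem mul_c_bac : c * (b * (a * c)) =
    (-1 / 4 * β) • a +
      (3 / 4 * γ) • b +
      (3 / 4 * α - 1 / 2 * ψ) • c +
      (-1 / 4 : F) • (a * b) +
      (-1 / 2 * γ) • (b * c) +
      (3 / 2 * β) • (a * c) +
      (-1 / 2 : F) • (a * (b * c)) := by
  obtain ⟨h4, h8, h16⟩ := four_eight_sixteen_ne_zero h2
  have e := H.pseudoComposition.trilinear h2 c b (a * c)
  simp only [mul_add, mul_smul_comm, mul_comm b a, mul_comm c b, mul_comm (a * c) (b * c), H.form_b_ac,
    H.form_cb, H.form_c_ac h2 h3, H.mul_c_ac h2, H.mul_bc_ac h2 h3] at e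
  linear_combination (norm := skip) e
  match_scalars <;> field_simp <;> ring

theorem mul_ab_abc : (a * b) * (a * (b * c)) =
    (3 / 2 * α * β - 1 / 4 * β + 3 / 4 * γ - 3 / 4 * ψ) • a +
      (-1 / 4 * β + 3 / 4 * ψ) • b +
      (-1 / 8 : F) • c +
      (-1 / 2 * β - 1 / 2 * ψ) • (a * b) +
      (3 / 4 * α + 1 / 8) • (b * c) +
      (-1 / 4 : F) • (a * c) +
      (-1 / 2 * α + 1 / 4) • (a * (b * c)) := by
  obtain ⟨h4, h8, h16⟩ := four_eight_sixteen_ne_zero h2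
  have e := H.pseudoComposition.idem_mul_mul_idem_mul h2 h3 H.axis_a.ne_zero H.axis_a.idem b (b * c)
  simp only [mul_add, mul_smul_comm, smul_add, map_add, map_smul, smul_eq_mul, H.form_ab, H.form_ac,
    H.form_b_bc h2 h3, H.form_a_bc h2 h3, H.mul_b_bc h2] at e
  linear_combination (norm := skip) e
  match_scalars <;> field_simp <;> ring

theorem mul_ac_abc : (a * c) * (a * (b * c)) =
    (3 / 4 * α + 3 / 2 * β * γ - 1 / 4 * β - 3 / 4 * ψ) • a +
      (-1 / 8 : F) • b +
      (-1 / 4 * β + 3 / 4 * ψ) • c +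
      (-1 / 4 : F) • (a * b) +
      (3 / 4 * γ + 1 / 8) • (b * c) +
      (-1 / 2 * β - 1 / 2 * ψ) • (a * c) +
      (-1 / 2 * γ + 1 / 4) • (a * (b * c)) := by
  obtain ⟨h4, h8, h16⟩ := four_eight_sixteen_ne_zero h2
  have e := H.pseudoComposition.idem_mul_mul_idem_mul h2 h3 H.axis_a.ne_zero H.axis_a.idem c (b * c)
  simp only [mul_add, mul_smul_comm, smul_add, map_add, map_smul, smul_eq_mul, H.form_ab, H.form_ac,
    H.form_c_bc h2 h3, H.form_a_bc h2 h3, H.mul_c_bc h2] at e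
  linear_combination (norm := skip) e
  match_scalars <;> field_simp <;> ring

theorem mul_ab_bac : (a * b) * (b * (a * c)) =
    (-1 / 4 * γ + 3 / 4 * ψ) • a +
      (3 / 2 * α * γ + 3 / 4 * β - 1 / 4 * γ - 3 / 4 * ψ) • b +
      (-1 / 8 : F) • c +
      (-1 / 2 * γ - 1 / 2 * ψ) • (a * b) +
      (-1 / 4 : F) • (b * c) +
      (3 / 4 * α + 1 / 8) • (a * c) +
      (-1 / 2 * α + 1 / 4) • (b * (a * c)) := by
  obtain ⟨h4, h8, h16⟩ := four_eight_sixteen_ne_zero h2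
  have e := H.pseudoComposition.idem_mul_mul_idem_mul h2 h3 H.axis_b.ne_zero H.axis_b.idem a (a * c)
  simp only [mul_add, mul_smul_comm, smul_add, map_add, map_smul, smul_eq_mul, mul_comm b a, H.form_bc,
    H.form_b_ac, H.form_ba, H.form_a_ac h2 h3, H.mul_a_ac h2] at e
  linear_combination (norm := skip) e
  match_scalars <;> field_simp <;> ring

theorem mul_bc_bac : (b * c) * (b * (a * c)) =
    (-1 / 8 : F) • a +
      (3 / 4 * α + 3 / 2 * β * γ - 1 / 4 * γ - 3 / 4 * ψ) • b +
      (-1 / 4 * γ + 3 / 4 * ψ) • c +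
      (-1 / 4 : F) • (a * b) +
      (-1 / 2 * γ - 1 / 2 * ψ) • (b * c) +
      (3 / 4 * β + 1 / 8) • (a * c) +
      (-1 / 2 * β + 1 / 4) • (b * (a * c)) := by
  obtain ⟨h4, h8, h16⟩ := four_eight_sixteen_ne_zero h2
  have e := H.pseudoComposition.idem_mul_mul_idem_mul h2 h3 H.axis_b.ne_zero H.axis_b.idem c (a * c)
  simp only [mul_add, mul_smul_comm, smul_add, map_add, map_smul, smul_eq_mul, mul_comm b a, H.form_bc,
    H.form_b_ac, H.form_ba, H.form_c_ac h2 h3, H.mul_c_ac h2] at e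
  linear_combination (norm := skip) e
  match_scalars <;> field_simp <;> ring

theorem form_bc_bc : φ (b * c) (b * c) = β ^ 2 - 1 / 2 * β + 1 / 2 := by
  rw [← H.pseudoComposition.form_assoc h2 h3, mul_comm _ b, H.mul_b_bc h2]
  simp only [map_add, map_smul, LinearMap.add_apply, LinearMap.smul_apply, smul_eq_mul,
    H.pseudoComposition.symm (b * c) c, H.form_cc, H.form_bc, H.form_c_bc h2 h3]
  ring

/-- No common axis can be factored out here, so the two-variable identity is applied to `bc` and
`a`, using the square of `bc`. -/
theorem mul_bc_abc : (b * c) * (a * (b * c)) =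
    (1 / 2 * β ^ 2 - 1 / 4 * β + 1 / 4) • a +
      (-3 / 4 * β + 1 / 8) • (a * b) +
      ψ • (b * c) +
      (-3 / 4 * β + 1 / 8) • (a * c) +
      (1 / 2 * β + 1 / 4) • (a * (b * c)) := by
  obtain ⟨h4, h8, h16⟩ := four_eight_sixteen_ne_zero h2
  have e := H.pseudoComposition.mul_mul_self_add h2 (b * c) a
  simp only [mul_add, mul_smul_comm, mul_comm (b * c) a, H.form_a_bc h2 h3, H.form_bc_bc h2 h3,
    H.pseudoComposition.symm (b * c) a, H.mul_bc_bc h2 h3] at e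
  linear_combination (norm := skip) (2 : F)⁻¹ • e
  match_scalars <;> field_simp <;> ring

theorem form_ac_ac : φ (a * c) (a * c) = γ ^ 2 - 1 / 2 * γ + 1 / 2 := by
  rw [← H.pseudoComposition.form_assoc h2 h3, mul_comm _ a, H.mul_a_ac h2]
  simp only [map_add, map_smul, LinearMap.add_apply, LinearMap.smul_apply, smul_eq_mul,
    H.pseudoComposition.symm (a * c) c, H.form_cc, H.form_ac, H.form_c_ac h2 h3]
  ring

theorem mul_ac_bac : (a * c) * (b * (a * c)) =
    (1 / 2 * γ ^ 2 - 1 / 4 * γ + 1 / 4) • b +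
      (-3 / 4 * γ + 1 / 8) • (a * b) +
      (-3 / 4 * γ + 1 / 8) • (b * c) +
      ψ • (a * c) +
      (1 / 2 * γ + 1 / 4) • (b * (a * c)) := by
  obtain ⟨h4, h8, h16⟩ := four_eight_sixteen_ne_zero h2
  have e := H.pseudoComposition.mul_mul_self_add h2 (a * c) b
  simp only [mul_add, mul_smul_comm, mul_comm b a, mul_comm (a * c) b, H.form_b_ac, H.form_ac_ac h2 h3,
    H.pseudoComposition.symm (a * c) b, H.mul_ac_ac h2 h3] at e
  linear_combination (norm := skip) (2 : F)⁻¹ • e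
  match_scalars <;> field_simp <;> ring

theorem mul_abc_abc : (a * (b * c)) * (a * (b * c)) =
    (9 / 4 * α * β - 3 / 8 * α - 1 / 4 * β ^ 2 + 9 / 4 * β * γ - 3 / 2 * β * ψ + 1 / 8 * β - 3 / 8 * γ - 3 / 4 * ψ - 1 / 8) • a +
      (-3 / 8 * β + 1 / 16) • b +
      (-3 / 8 * β + 1 / 16) • c +
      (-3 / 4 * β + 1 / 8) • (a * b) +
      (1 / 4 * β + 3 / 2 * ψ + 1 / 8) • (b * c) +
      (-3 / 4 * β + 1 / 8) • (a * c) +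
      (1 / 2 * β - ψ + 1 / 4) • (a * (b * c)) := by
  obtain ⟨h4, h8, h16⟩ := four_eight_sixteen_ne_zero h2
  have e := H.pseudoComposition.idem_mul_mul_idem_mul h2 h3 H.axis_a.ne_zero H.axis_a.idem (b * c) (b * c)
  simp only [mul_add, mul_sub, mul_smul_comm, smul_add, map_add, map_smul, smul_eq_mul, H.form_ab,
    H.form_ac, H.form_a_bc h2 h3, H.form_bc_bc h2 h3, H.mul_bc_bc h2 h3] at e
  linear_combination (norm := skip) e
  match_scalars <;> field_simp <;> ring

theorem mul_bac_bac : (b * (a * c)) * (b * (a * c)) =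
    (-3 / 8 * γ + 1 / 16) • a +
      (9 / 4 * α * γ - 3 / 8 * α + 9 / 4 * β * γ - 3 / 8 * β - 1 / 4 * γ ^ 2 - 3 / 2 * γ * ψ + 1 / 8 * γ - 3 / 4 * ψ - 1 / 8) • b +
      (-3 / 8 * γ + 1 / 16) • c +
      (-3 / 4 * γ + 1 / 8) • (a * b) +
      (-3 / 4 * γ + 1 / 8) • (b * c) +
      (1 / 4 * γ + 3 / 2 * ψ + 1 / 8) • (a * c) +
      (1 / 2 * γ - ψ + 1 / 4) • (b * (a * c)) := by
  obtain ⟨h4, h8, h16⟩ := four_eight_sixteen_ne_zero h2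
  have e := H.pseudoComposition.idem_mul_mul_idem_mul h2 h3 H.axis_b.ne_zero H.axis_b.idem (a * c) (a * c)
  simp only [mul_add, mul_sub, mul_smul_comm, smul_add, map_add, map_smul, smul_eq_mul, mul_comm b a,
    H.form_bc, H.form_b_ac, H.form_ba, H.form_ac_ac h2 h3, H.mul_ac_ac h2 h3] at e
  linear_combination (norm := skip) e
  match_scalars <;> field_simp <;> ring

theorem form_ab_ab : φ (a * b) (a * b) = α ^ 2 - 1 / 2 * α + 1 / 2 := by
  rw [← H.pseudoComposition.form_assoc h2 h3, mul_comm _ a, H.mul_a_ab h2]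
  simp only [map_add, map_smul, LinearMap.add_apply, LinearMap.smul_apply, smul_eq_mul,
    H.pseudoComposition.symm (a * b) b, H.form_bb, H.form_ab, H.form_b_ab h2 h3]
  ring

/-- The square of `c(ab)` is evaluated twice: by the formula for the axis `c`, and by writing
`c(ab)` through `a(bc)` and `b(ac)`. The cross term of the second expansion is twice the product
sought. -/
theorem mul_abc_bac : (a * (b * c)) * (b * (a * c)) =
    (-3 / 8 * α * β - 1 / 8 * β ^ 2 - 7 / 8 * β * γ + 3 / 4 * β * ψ + 1 / 16 * β + 3 / 8 * γ + 3 / 8 * ψ + 1 / 16) • a +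
      (-3 / 8 * α * γ - 7 / 8 * β * γ + 3 / 8 * β - 1 / 8 * γ ^ 2 + 3 / 4 * γ * ψ + 1 / 16 * γ + 3 / 8 * ψ + 1 / 16) • b +
      (9 / 8 * α ^ 2 + 3 / 8 * α * β + 3 / 8 * α * γ - 9 / 4 * α * ψ + 3 / 16 * α - 3 / 8 * ψ - 1 / 8) • c +
      (-3 / 8 * α - 2 * β * γ + 3 / 8 * β + 3 / 8 * γ + 3 / 4 * ψ - 1 / 16) • (a * b) +
      (3 / 2 * α * γ - 3 / 8 * α + 1 / 8 * β + 3 / 8 * γ - 3 / 4 * ψ - 1 / 16) • (b * c) +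
      (3 / 2 * α * β - 3 / 8 * α + 3 / 8 * β + 1 / 8 * γ - 3 / 4 * ψ - 1 / 16) • (a * c) +
      (-3 / 4 * α - 1 / 4 * β + 1 / 2 * γ + ψ - 1 / 4) • (a * (b * c)) +
      (-3 / 4 * α + 1 / 2 * β - 1 / 4 * γ + ψ - 1 / 4) • (b * (a * c)) := by
  obtain ⟨h4, h8, h16⟩ := four_eight_sixteen_ne_zero h2
  have e := H.pseudoComposition.idem_mul_mul_idem_mul h2 h3 H.axis_c.ne_zero H.axis_c.idem (a * b) (a * b)
  simp only [mul_add, mul_sub, mul_smul_comm, smul_add, map_add, map_smul, smul_eq_mul, add_mul,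
    smul_mul_assoc, H.axis_a.idem, H.axis_b.idem, H.axis_c.idem, mul_comm b a, mul_comm c a,
    mul_comm c b, mul_comm (a * (b * c)) a, mul_comm (b * (a * c)) a, mul_comm (a * (b * c)) b,
    mul_comm (b * (a * c)) b, mul_comm (a * (b * c)) c, mul_comm (b * (a * c)) c,
    mul_comm (b * (a * c)) (a * (b * c)), H.form_cb, H.form_ca, H.form_c_ab h2 h3,
    H.form_ab_ab h2 h3, H.mul_a_abc h2 h3, H.mul_b_bac h2, H.mul_c_ab h2,
    H.mul_ab_ab h2 h3, H.mul_b_abc h2 h3, H.mul_c_abc h2 h3, H.mul_a_bac h2 h3,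
    H.mul_c_bac h2 h3, H.mul_abc_abc h2 h3, H.mul_bac_bac h2 h3] at e
  linear_combination (norm := skip) (2 : F)⁻¹ • e
  match_scalars <;> field_simp <;> ring

end Product

end IsThreeGenerated

/-! ### The universal property and the group `T`. -/

namespace IsThreeGenerated

variable {F A B : Type*} [Field F] [NonUnitalNonAssocCommRing A] [Module F A]
  [IsScalarTower F A A] [SMulCommClass F A A] [NonUnitalNonAssocCommRing B] [Module F B]
  [IsScalarTower F B B] [SMulCommClass F B B] {φ : LinearMap.BilinForm F A}
  {φ' : LinearMap.BilinForm F B} {a b c : A} {a' b' c' : B} {α β γ ψ : F}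

/-- The eight products of three generators that span a pseudo-composition algebra. -/
def spanningFamily {A : Type*} [Mul A] (a b c : A) : Fin 8 → A :=
  ![a, b, c, a * b, b * c, a * c, a * (b * c), b * (a * c)]

/-- Both algebras obey the same table, whose coefficients involve only the parameters. -/
theorem map_spanningFamily_mul (H : IsThreeGenerated F φ a b c α β γ ψ)
    (H' : IsThreeGenerated F φ' a' b' c' α β γ ψ) (h2 : (2 : F) ≠ 0) (h3 : (3 : F) ≠ 0)
    (f : A →ₗ[F] B) (hf : ∀ i, f (spanningFamily a b c i) = spanningFamily a' b' c' i)
    (i j : Fin 8) : f (spanningFamily a b c i * spanningFamily a b c j) =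
      spanningFamily a' b' c' i * spanningFamily a' b' c' j := by
  have h0 : f a = a' := hf 0
  have h1 : f b = b' := hf 1
  have h2' : f c = c' := hf 2
  have h3' : f (a * b) = a' * b' := hf 3
  have h4 : f (b * c) = b' * c' := hf 4
  have h5 : f (a * c) = a' * c' := hf 5
  have h6 : f (a * (b * c)) = a' * (b' * c') := hf 6
  have h7 : f (b * (a * c)) = b' * (a' * c') := hf 7
  wlog hij : i ≤ j generalizing i j
  · rw [mul_comm, this j i (le_of_not_ge hij), mul_comm]
  fin_cases i <;> fin_cases j <;> first | exact absurd hij (by decide) | skip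
  all_goals simp only [spanningFamily, Fin.zero_eta, Fin.mk_one, Fin.reduceFinMk, Matrix.cons_val,
    Matrix.cons_val_zero, Matrix.cons_val_one, map_add, map_smul, h0, h1, h2', h3', h4, h5, h6, h7,
    H.axis_a.idem, H.axis_b.idem, H.axis_c.idem, H.mul_a_ab h2, H.mul_b_ab h2,
    H.mul_b_bc h2, H.mul_c_bc h2, H.mul_a_ac h2, H.mul_c_ac h2, H.mul_a_abc h2 h3,
    H.mul_b_bac h2, H.mul_c_ab h2, H.mul_ab_ac h2 h3, H.mul_ab_bc h2 h3,
    H.mul_bc_ac h2 h3, H.mul_ab_ab h2 h3, H.mul_bc_bc h2 h3, H.mul_ac_ac h2 h3,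
    H.mul_b_abc h2 h3, H.mul_c_abc h2 h3, H.mul_a_bac h2 h3, H.mul_c_bac h2 h3,
    H.mul_ab_abc h2 h3, H.mul_ac_abc h2 h3, H.mul_ab_bac h2 h3, H.mul_bc_bac h2 h3,
    H.mul_bc_abc h2 h3, H.mul_ac_bac h2 h3, H.mul_abc_abc h2 h3, H.mul_bac_bac h2 h3,
    H.mul_abc_bac h2 h3, H'.axis_a.idem, H'.axis_b.idem, H'.axis_c.idem, H'.mul_a_ab h2,
    H'.mul_b_ab h2, H'.mul_b_bc h2, H'.mul_c_bc h2, H'.mul_a_ac h2,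
    H'.mul_c_ac h2, H'.mul_a_abc h2 h3, H'.mul_b_bac h2, H'.mul_c_ab h2,
    H'.mul_ab_ac h2 h3, H'.mul_ab_bc h2 h3, H'.mul_bc_ac h2 h3, H'.mul_ab_ab h2 h3,
    H'.mul_bc_bc h2 h3, H'.mul_ac_ac h2 h3, H'.mul_b_abc h2 h3, H'.mul_c_abc h2 h3,
    H'.mul_a_bac h2 h3, H'.mul_c_bac h2 h3, H'.mul_ab_abc h2 h3, H'.mul_ac_abc h2 h3,
    H'.mul_ab_bac h2 h3, H'.mul_bc_bac h2 h3, H'.mul_bc_abc h2 h3, H'.mul_ac_bac h2 h3,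
    H'.mul_abc_abc h2 h3, H'.mul_bac_bac h2 h3, H'.mul_abc_bac h2 h3]

theorem spanningFamily_mul_mem (H : IsThreeGenerated F φ a b c α β γ ψ) (h2 : (2 : F) ≠ 0)
    (h3 : (3 : F) ≠ 0) (i j : Fin 8) : spanningFamily a b c i * spanningFamily a b c j ∈
      Submodule.span F (Set.range (spanningFamily a b c)) := by
  have m (k : Fin 8) : spanningFamily a b c k ∈
      Submodule.span F (Set.range (spanningFamily a b c)) := Submodule.subset_span ⟨k, rfl⟩
  set p := Submodule.span F (Set.range (spanningFamily a b c))
  have m0 : a ∈ p := m 0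
  have m1 : b ∈ p := m 1
  have m2 : c ∈ p := m 2
  have m3 : a * b ∈ p := m 3
  have m4 : b * c ∈ p := m 4
  have m5 : a * c ∈ p := m 5
  have m6 : a * (b * c) ∈ p := m 6
  have m7 : b * (a * c) ∈ p := m 7
  wlog hij : i ≤ j generalizing i j
  · rw [mul_comm]
    exact this j i (le_of_not_ge hij)
  fin_cases i <;> fin_cases j <;> first | exact absurd hij (by decide) | skip
  all_goals
    simp only [spanningFamily, Fin.zero_eta, Fin.mk_one, Fin.reduceFinMk, Matrix.cons_val,
      Matrix.cons_val_zero, Matrix.cons_val_one, 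
      H.axis_a.idem, H.axis_b.idem, H.axis_c.idem, H.mul_a_ab h2, H.mul_b_ab h2,
      H.mul_b_bc h2, H.mul_c_bc h2, H.mul_a_ac h2, H.mul_c_ac h2, H.mul_a_abc h2 h3,
      H.mul_b_bac h2, H.mul_c_ab h2, H.mul_ab_ac h2 h3, H.mul_ab_bc h2 h3,
      H.mul_bc_ac h2 h3, H.mul_ab_ab h2 h3, H.mul_bc_bc h2 h3, H.mul_ac_ac h2 h3,
      H.mul_b_abc h2 h3, H.mul_c_abc h2 h3, H.mul_a_bac h2 h3, H.mul_c_bac h2 h3,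
      H.mul_ab_abc h2 h3, H.mul_ac_abc h2 h3, H.mul_ab_bac h2 h3, H.mul_bc_bac h2 h3,
      H.mul_bc_abc h2 h3, H.mul_ac_bac h2 h3, H.mul_abc_abc h2 h3, H.mul_bac_bac h2 h3,
      H.mul_abc_bac h2 h3]
    first
    | assumption
    | repeat' first | apply Submodule.add_mem | apply Submodule.smul_mem
      all_goals assumption

theorem span_spanningFamily (H : IsThreeGenerated F φ a b c α β γ ψ) (h2 : (2 : F) ≠ 0)
    (h3 : (3 : F) ≠ 0) : Submodule.span F (Set.range (spanningFamily a b c)) = ⊤ := by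
  have hmul (x y : A) (hx : x ∈ Submodule.span F (Set.range (spanningFamily a b c)))
      (hy : y ∈ Submodule.span F (Set.range (spanningFamily a b c))) :
      x * y ∈ Submodule.span F (Set.range (spanningFamily a b c)) := by
    induction hx, hy using Submodule.span_induction₂ with
    | mem_mem x y hx hy =>
      obtain ⟨i, rfl⟩ := hx
      obtain ⟨j, rfl⟩ := hy
      exact H.spanningFamily_mul_mem h2 h3 i j
    | zero_left => simp
    | zero_right => simp
    | add_left x y z _ _ _ h h' => rw [add_mul]; exact add_mem h h'
    | add_right x y z _ _ _ h h' => rw [mul_add]; exact add_mem h h'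
    | smul_left r x y _ _ h => rw [smul_mul_assoc]; exact Submodule.smul_mem _ _ h
    | smul_right r x y _ _ h => rw [mul_smul_comm]; exact Submodule.smul_mem _ _ h
  rw [eq_top_iff]
  intro x _
  have hx : x ∈ NonUnitalAlgebra.adjoin F ({a, b, c} : Set A) := by
    rw [H.generates]
    trivial
  have hle : NonUnitalAlgebra.adjoin F ({a, b, c} : Set A) ≤
      (Submodule.span F (Set.range (spanningFamily a b c))).toNonUnitalSubalgebra hmul := by
    rw [NonUnitalAlgebra.adjoin_le_iff]
    rintro y (rfl | rfl | rfl)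
    · exact Submodule.subset_span ⟨0, rfl⟩
    · exact Submodule.subset_span ⟨1, rfl⟩
    · exact Submodule.subset_span ⟨2, rfl⟩
  exact hle hx

/-- The spanning family is a basis of the source, so a linear map matching the two families exists,
and multiplicativity is checked on the basis. The target family may be dependent. -/
theorem exists_surjective_hom (H : IsThreeGenerated F φ a b c α β γ ψ)
    (H' : IsThreeGenerated F φ' a' b' c' α β γ ψ) (h2 : (2 : F) ≠ 0) (h3 : (3 : F) ≠ 0)
    (hli : LinearIndependent F (spanningFamily a b c)) :
    ∃ f : A →ₙₐ[F] B, Function.Surjective f ∧ f a = a' ∧ f b = b' ∧ f c = c' := by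
  let v := Module.Basis.mk hli (H.span_spanningFamily h2 h3).ge
  let f := v.constr F (spanningFamily a' b' c')
  have hv (i) : v i = spanningFamily a b c i := Module.Basis.mk_apply _ _ i
  have hf (i) : f (spanningFamily a b c i) = spanningFamily a' b' c' i := by
    rw [← hv, Module.Basis.constr_basis]
  have hmul : (LinearMap.mul F A).compr₂ f = (LinearMap.mul F B).compl₁₂ f f := by
    refine LinearMap.ext_basis v v fun i j => ?_
    simp only [hv, LinearMap.compr₂_apply, LinearMap.mul_apply', LinearMap.compl₁₂_apply, hf]
    exact H.map_spanningFamily_mul H' h2 h3 f hf i j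
  refine ⟨{ f with
    map_mul' := fun x y => LinearMap.congr_fun₂ hmul x y
    map_zero' := map_zero f }, ?_, hf 0, hf 1, hf 2⟩
  refine LinearMap.range_eq_top.1 (?_ : LinearMap.range f = ⊤)
  rw [eq_top_iff, ← H'.span_spanningFamily h2 h3, Submodule.span_le]
  rintro _ ⟨i, rfl⟩
  exact ⟨_, hf i⟩

omit [IsScalarTower F B B] [SMulCommClass F B B] in
theorem hom_ext (H : IsThreeGenerated F φ a b c α β γ ψ) {f g : A →ₙₐ[F] B} (ha : f a = g a)
    (hb : f b = g b) (hc : f c = g c) (x : A) : f x = g x := by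
  have hx : x ∈ NonUnitalAlgebra.adjoin F ({a, b, c} : Set A) := by
    rw [H.generates]
    trivial
  induction hx using NonUnitalAlgebra.adjoin_induction with
  | mem x hx => rcases hx with rfl | rfl | rfl <;> assumption
  | add x y _ _ h h' => rw [map_add, map_add, h, h']
  | zero => rw [map_zero, map_zero]
  | mul x y _ _ h h' => rw [map_mul, map_mul, h, h']
  | smul r x _ h => rw [map_smul, map_smul, h]

/-- Independence in the target yields a homomorphism back, which inverts `f` on the generators and
hence everywhere. -/
theorem injective_of_linearIndependent (H : IsThreeGenerated F φ a b c α β γ ψ)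
    (H' : IsThreeGenerated F φ' a' b' c' α β γ ψ) (h2 : (2 : F) ≠ 0) (h3 : (3 : F) ≠ 0)
    (hli : LinearIndependent F (spanningFamily a' b' c')) (f : A →ₙₐ[F] B)
    (ha : f a = a') (hb : f b = b') (hc : f c = c') : Function.Injective f := by
  obtain ⟨g, -, hga, hgb, hgc⟩ := H'.exists_surjective_hom H h2 h3 hli
  refine Function.LeftInverse.injective (g := g) fun x => ?_
  exact H.hom_ext (f := g.comp f) (g := NonUnitalAlgHom.id F A) (by simp [*]) (by simp [*])
    (by simp [*]) x

theorem of_bijective (H : IsThreeGenerated F φ a b c α β γ ψ) (h2 : (2 : F) ≠ 0)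
    (e : A ≃ₗ[F] B) (he : ∀ x y, e (x * y) = e x * e y) :
    IsThreeGenerated F (φ.compl₁₂ e.symm.toLinearMap e.symm.toLinearMap) (e a) (e b) (e c)
      α β γ ψ := by
  have hp : IsPseudoComposition F (φ.compl₁₂ e.symm.toLinearMap e.symm.toLinearMap) := by
    refine ⟨fun x y => H.pseudoComposition.symm _ _, fun h0 => H.pseudoComposition.ne_zero ?_,
      fun x => ?_⟩
    · ext x y
      simpa using LinearMap.congr_fun₂ h0 (e x) (e y)
    · obtain ⟨y, rfl⟩ := e.surjective x
      rw [← he, ← he, H.pseudoComposition.cube]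
      simp
  have hi {x : A} (hx : IsPrimitiveIdempotent F x) : IsPrimitiveIdempotent F (e x) :=
    hp.isPrimitiveIdempotent h2 (by simpa using hx.ne_zero) (by rw [← he, hx.idem])
  refine ⟨hp, hi H.axis_a, hi H.axis_b, hi H.axis_c, ?_, by simp [H.form_ab], by simp [H.form_bc],
    by simp [H.form_ac], by simp [← he, H.form_b_ac]⟩
  rw [eq_top_iff]
  rintro x -
  obtain ⟨y, rfl⟩ := e.surjective x
  have hy : y ∈ NonUnitalAlgebra.adjoin F ({a, b, c} : Set A) := by
    rw [H.generates]
    trivial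
  induction hy using NonUnitalAlgebra.adjoin_induction with
  | mem x hx =>
    refine NonUnitalAlgebra.subset_adjoin F ?_
    rcases hx with rfl | rfl | rfl <;> simp
  | add x y _ _ h h' => rw [map_add]; exact add_mem h h'
  | zero => rw [map_zero]; exact zero_mem _
  | mul x y _ _ h h' => rw [he]; exact mul_mem h h'
  | smul r x _ h => rw [map_smul]; exact SMulMemClass.smul_mem r h

/-- The quadratic formula makes each Miyamoto involution unique, so `T` is the range of `ρ`. The
kernel consists of the elements fixing the three axes, which are those commuting with a generating
set. -/
theorem nonempty_miyamotoGroup_mulEquiv (H : IsThreeGenerated F φ a b c α β γ ψ)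
    (h2 : (2 : F) ≠ 0) (h3 : (3 : F) ≠ 0) {G : Type*} [Group G] (ρ : G →* (A ≃ₗ[F] A))
    (hρ : ∀ g x y, ρ g (x * y) = ρ g x * ρ g y) {ra rb rc : G}
    (hG : Subgroup.closure {ra, rb, rc} = ⊤)
    (ha : IsMiyamotoInvolution F a (ρ ra)) (hb : IsMiyamotoInvolution F b (ρ rb))
    (hc : IsMiyamotoInvolution F c (ρ rc))
    (ca : ∀ g, ρ g a = a ↔ g * ra = ra * g) (cb : ∀ g, ρ g b = b ↔ g * rb = rb * g)
    (cc : ∀ g, ρ g c = c ↔ g * rc = rc * g) :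
    Nonempty (miyamotoGroup F a b c ≃* G ⧸ Subgroup.center G) := by
  have hu {e : A} (he : IsPrimitiveIdempotent F e) {τ σ : A ≃ₗ[F] A}
      (hτ : IsMiyamotoInvolution F e τ) (hσ : IsMiyamotoInvolution F e σ) : τ = σ := by
    ext x
    refine smul_right_injective A h3 ?_
    simp only
    rw [H.pseudoComposition.miyamotoInvolution_apply h2 he.ne_zero he.idem hτ,
      H.pseudoComposition.miyamotoInvolution_apply h2 he.ne_zero he.idem hσ]
  have hset : {τ | IsMiyamotoInvolution F a τ ∨ IsMiyamotoInvolution F b τ ∨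
      IsMiyamotoInvolution F c τ} = ρ '' {ra, rb, rc} := by
    ext τ
    simp only [Set.image_insert_eq, Set.image_singleton, Set.mem_insert_iff,
      Set.mem_singleton_iff]
    constructor
    · rintro (h | h | h)
      · exact Or.inl (hu H.axis_a h ha)
      · exact Or.inr (Or.inl (hu H.axis_b h hb))
      · exact Or.inr (Or.inr (hu H.axis_c h hc))
    · rintro (rfl | rfl | rfl)
      exacts [Or.inl ha, Or.inr (Or.inl hb), Or.inr (Or.inr hc)]
  have hrange : miyamotoGroup F a b c = ρ.range := by
    rw [miyamotoGroup, hset, ← MonoidHom.map_closure, hG, MonoidHom.range_eq_map]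
  have hker : ρ.ker = Subgroup.center G := by
    ext g
    rw [MonoidHom.mem_ker]
    constructor
    · intro hg
      have hle : Subgroup.closure {ra, rb, rc} ≤ Subgroup.centralizer {g} := by
        rw [Subgroup.closure_le]
        rintro x (rfl | rfl | rfl) <;>
          rw [SetLike.mem_coe, Subgroup.mem_centralizer_singleton_iff]
        · exact ((ca g).1 (by rw [hg]; rfl)).symm
        · exact ((cb g).1 (by rw [hg]; rfl)).symm
        · exact ((cc g).1 (by rw [hg]; rfl)).symm
      rw [hG] at hle
      rw [Subgroup.mem_center_iff]
      intro k
      exact Subgroup.mem_centralizer_singleton_iff.1 (hle (Subgroup.mem_top k))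
    · intro hg
      rw [Subgroup.mem_center_iff] at hg
      ext x
      let f : A →ₙₐ[F] A := { (ρ g).toLinearMap with
        map_mul' := hρ g
        map_zero' := map_zero (ρ g) }
      exact H.hom_ext (f := f) (g := NonUnitalAlgHom.id F A) ((ca g).2 (hg ra).symm)
        ((cb g).2 (hg rb).symm) ((cc g).2 (hg rc).symm) x
  exact ⟨(MulEquiv.subgroupCongr hrange).trans
    ((QuotientGroup.quotientKerEquivRange ρ).symm.trans
      (QuotientGroup.quotientMulEquivOfEq hker))⟩

end IsThreeGenerated

/-! ### From a concrete model to all universal algebras. -/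

instance ULift.instNonUnitalNonAssocCommRing {A : Type*} [NonUnitalNonAssocCommRing A] :
    NonUnitalNonAssocCommRing (ULift A) where
  mul_comm x y := ULift.ext _ _ (mul_comm x.down y.down)

instance ULift.instSMulCommClass {F A : Type*} [Mul A] [SMul F A] [SMulCommClass F A A] :
    SMulCommClass F (ULift A) (ULift A) where
  smul_comm r x y := ULift.ext _ _ (smul_comm r x.down y.down)

/-- A concrete three-generated algebra whose eight products are independent is universal, and its
Miyamoto group can be read off from any group acting on it through conjugations. -/
theorem universalMiyamotoGroupIso_of_model {F : Type*} [Field F] (h2 : (2 : F) ≠ 0)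
    (h3 : (3 : F) ≠ 0) {A : Type} [NonUnitalNonAssocCommRing A] [Module F A]
    [IsScalarTower F A A] [SMulCommClass F A A] {φ : LinearMap.BilinForm F A} {a b c : A}
    {α β γ ψ : F} (H : IsThreeGenerated F φ a b c α β γ ψ)
    (hli : LinearIndependent F (IsThreeGenerated.spanningFamily a b c))
    {G : Type*} [Group G] (ρ : G →* (A ≃ₗ[F] A))
    (hρ : ∀ g x y, ρ g (x * y) = ρ g x * ρ g y) {ra rb rc : G}
    (hG : Subgroup.closure {ra, rb, rc} = ⊤)
    (ha : IsMiyamotoInvolution F a (ρ ra)) (hb : IsMiyamotoInvolution F b (ρ rb))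
    (hc : IsMiyamotoInvolution F c (ρ rc))
    (ca : ∀ g, ρ g a = a ↔ g * ra = ra * g) (cb : ∀ g, ρ g b = b ↔ g * rb = rb * g)
    (cc : ∀ g, ρ g c = c ↔ g * rc = rc * g) :
    UniversalMiyamotoGroupIso.{u} F α β γ ψ (G ⧸ Subgroup.center G) := by
  -- Universality quantifies over `Type u`, whereas the model lives in `Type`.
  let e : A ≃ₗ[F] ULift.{u} A := ULift.moduleEquiv.symm
  have he (x y : A) : e (x * y) = e x * e y := rfl
  have He := H.of_bijective h2 e he
  have hlie : LinearIndependent F (IsThreeGenerated.spanningFamily (e a) (e b) (e c)) := by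
    have h : IsThreeGenerated.spanningFamily (e a) (e b) (e c) =
        e ∘ IsThreeGenerated.spanningFamily a b c := by
      ext i
      fin_cases i <;> rfl
    rw [h]
    exact hli.map' e.toLinearMap e.ker
  refine ⟨⟨ULift.{u} A, inferInstance, inferInstance, inferInstance, inferInstance, _, e a, e b,
    e c, He, fun B _ _ _ _ φ' a' b' c' H' => He.exists_surjective_hom H' h2 h3 hlie⟩, ?_⟩
  intro B _ _ _ _ φ' a' b' c' H'
  -- Universality of `B` gives a surjection onto the model, and independence of the eight products
  -- there makes it injective. The action of `G` is then transported to `B`.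
  obtain ⟨f, hf, fa, fb, fc⟩ := H'.universal (ULift.{u} A) _ _ _ _ He
  have hinj := H'.threeGenerated.injective_of_linearIndependent He h2 h3 hlie f fa fb fc
  let f' : B ≃ₗ[F] A := (LinearEquiv.ofBijective
    ({ f with map_smul' := map_smul f } : B →ₗ[F] ULift.{u} A) ⟨hinj, hf⟩).trans e.symm
  have fmul (x y : B) : f' (x * y) = f' x * f' y := congrArg e.symm (map_mul f x y)
  have fa' : f' a' = a := congrArg e.symm fa
  have fb' : f' b' = b := congrArg e.symm fb
  have fc' : f' c' = c := congrArg e.symm fc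
  let ρ' : G →* (B ≃ₗ[F] B) :=
    { toFun g := (f'.trans (ρ g)).trans f'.symm
      map_one' := by ext x; simp
      map_mul' g k := by ext x; simp }
  have hρ' (g : G) (x : B) : ρ' g x = f'.symm (ρ g (f' x)) := rfl
  have hfix (g : G) (x : B) : ρ' g x = x ↔ ρ g (f' x) = f' x := by
    rw [hρ', LinearEquiv.symm_apply_eq]
  have hmi {x : B} {r : G} (h : IsMiyamotoInvolution F (f' x) (ρ r)) :
      IsMiyamotoInvolution F x (ρ' r) := by
    have hm {x : B} {μ : F} {y : B} (hy : y ∈ axisEigenspace F x μ) :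
        f' y ∈ axisEigenspace F (f' x) μ := by
      simp only [axisEigenspace, Module.End.mem_eigenspace_iff, LinearMap.mulLeft_apply] at hy ⊢
      rw [← fmul, hy, map_smul]
    refine ⟨fun y hy => ?_, fun y hy => ?_⟩
    · obtain ⟨z, hz, w, hw, rfl⟩ := Submodule.mem_sup.1 hy
      rw [hfix, map_add]
      exact h.1 _ (Submodule.add_mem_sup (hm hz) (hm hw))
    · rw [hρ', h.2 _ (hm hy), map_neg, LinearEquiv.symm_apply_apply]
  refine H'.threeGenerated.nonempty_miyamotoGroup_mulEquiv h2 h3 ρ' (fun g x y => ?_) hG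
    (hmi (by rwa [fa'])) (hmi (by rwa [fb'])) (hmi (by rwa [fc']))
    (fun g => by rw [hfix, fa', ca]) (fun g => by rw [hfix, fb', cb])
    (fun g => by rw [hfix, fc', cc])
  rw [hρ', fmul, hρ, hρ', hρ', LinearEquiv.symm_apply_eq, fmul]
  simp

/-! ### Traceless `3 × 3` matrices as pseudo-composition algebras. -/

open Matrix

/-- The commutative product `(XY + YX)/2 - tr(XY)/3` on traceless `3 × 3` matrices, where `h` and
`t` stand for `1/2` and `1/3`. -/
def tracelessMul {F K : Type*} [Field F] [CommRing K] [Algebra F K] (h t : F)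
    (X Y : Matrix (Fin 3) (Fin 3) K) : Matrix (Fin 3) (Fin 3) K :=
  h • (X * Y + Y * X) - t • ((X * Y).trace • (1 : Matrix (Fin 3) (Fin 3) K))

/-- The traceless matrix `3p - 1` attached to `p = v wᵀ`. -/
def axisMatrix {K : Type*} [CommRing K] (v w : Fin 3 → K) : Matrix (Fin 3) (Fin 3) K :=
  (3 : K) • vecMulVec v w - 1

/-- The reflection `2p - 1` attached to `p = v wᵀ`. -/
def reflectionMatrix {K : Type*} [CommRing K] (v w : Fin 3 → K) : Matrix (Fin 3) (Fin 3) K :=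
  (2 : K) • vecMulVec v w - 1

/-- An `F`-space of traceless `3 × 3` matrices over `K` that is closed under the commutative
product and on which the trace form takes values in `F`, with eight coordinates. -/
structure TracelessModel (F K : Type) [Field F] [CommRing K] [Algebra F K] where
  half : F
  third : F
  two_mul_half : 2 * half = 1
  three_mul_third : 3 * third = 1
  carrier : Submodule F (Matrix (Fin 3) (Fin 3) K)
  re : K →ₗ[F] F
  trace_eq_zero : ∀ X ∈ carrier, X.trace = 0
  mul_mem : ∀ X ∈ carrier, ∀ Y ∈ carrier, tracelessMul half third X Y ∈ carrier
  trace_mul : ∀ X ∈ carrier, ∀ Y ∈ carrier,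
    algebraMap F K (re (X * Y).trace) = (X * Y).trace
  coord : Matrix (Fin 3) (Fin 3) K →ₗ[F] (Fin 8 → F)
  coord_inj : ∀ X ∈ carrier, coord X = 0 → X = 0

/-- Cayley–Hamilton, doubled because for trace zero the second elementary symmetric function is
`-tr(X²)/2`. -/
theorem two_smul_cube_of_trace_eq_zero {K : Type*} [CommRing K] (X : Matrix (Fin 3) (Fin 3) K)
    (hX : X.trace = 0) :
    (2 : K) • (X * X * X) = (X * X).trace • X + (2 * X.det) • 1 := by
  rw [trace_fin_three] at hX
  have h22 : X 2 2 = -X 0 0 - X 1 1 := by linear_combination hX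
  ext i j
  fin_cases i <;> fin_cases j <;>
    simp [mul_apply, Fin.sum_univ_three, trace_fin_three, det_fin_three, h22] <;> ring

namespace TracelessModel

variable {F K : Type} [Field F] [CommRing K] [Algebra F K] (M : TracelessModel F K)

theorem two_ne_zero (M : TracelessModel F K) : (2 : F) ≠ 0 := fun h => by simpa [h] using M.two_mul_half

theorem three_ne_zero (M : TracelessModel F K) : (3 : F) ≠ 0 := fun h => by simpa [h] using M.three_mul_third

instance : Mul M.carrier :=
  ⟨fun X Y => ⟨tracelessMul M.half M.third X.1 Y.1, M.mul_mem X.1 X.2 Y.1 Y.2⟩⟩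

theorem coe_mul (X Y : M.carrier) :
    ((X * Y : M.carrier) : Matrix (Fin 3) (Fin 3) K) = tracelessMul M.half M.third X.1 Y.1 := rfl

instance : NonUnitalNonAssocCommRing M.carrier where
  left_distrib X Y Z := Subtype.ext <| by
    simp only [coe_mul, tracelessMul, Submodule.coe_add, mul_add, add_mul, trace_add, add_smul,
      smul_add]
    abel
  right_distrib X Y Z := Subtype.ext <| by
    simp only [coe_mul, tracelessMul, Submodule.coe_add, mul_add, add_mul, trace_add, add_smul,
      smul_add]
    abel
  zero_mul X := Subtype.ext <| by simp [coe_mul, tracelessMul]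
  mul_zero X := Subtype.ext <| by simp [coe_mul, tracelessMul]
  mul_comm X Y := Subtype.ext <| by
    rw [coe_mul, coe_mul, tracelessMul, tracelessMul, trace_mul_comm, add_comm]

instance : IsScalarTower F M.carrier M.carrier where
  smul_assoc r X Y := Subtype.ext <| by
    simp only [smul_eq_mul, coe_mul, tracelessMul, Submodule.coe_smul, smul_mul_assoc,
      mul_smul_comm, trace_smul, smul_assoc, smul_sub, smul_add, smul_comm r]

instance : SMulCommClass F M.carrier M.carrier where
  smul_comm r X Y := Subtype.ext <| by
    simp only [smul_eq_mul, coe_mul, tracelessMul, Submodule.coe_smul, smul_mul_assoc,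
      mul_smul_comm, trace_smul, smul_assoc, smul_sub, smul_add, smul_comm r]

/-- The form `tr(XY)/6`. -/
def form : LinearMap.BilinForm F M.carrier :=
  LinearMap.mk₂ F (fun X Y => M.half * M.third * M.re (X.1 * Y.1).trace)
    (fun X Y Z => by simp [add_mul, mul_add]) (fun r X Y => by simp; ring)
    (fun X Y Z => by simp [mul_add]) (fun r X Y => by simp; ring)

theorem form_apply (X Y : M.carrier) :
    M.form X Y = M.half * M.third * M.re (X.1 * Y.1).trace := rfl

theorem algebraMap_form (X Y : M.carrier) : algebraMap F K (M.form X Y) =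
    algebraMap F K M.half * algebraMap F K M.third * (X.1 * Y.1).trace := by
  rw [form_apply, map_mul, map_mul, M.trace_mul _ X.2 _ Y.2]

theorem two_mul_algebraMap_half : 2 * algebraMap F K M.half = 1 := by
  simpa only [map_mul, map_ofNat, map_one] using congrArg (algebraMap F K) M.two_mul_half

theorem three_mul_algebraMap_third : 3 * algebraMap F K M.third = 1 := by
  simpa only [map_mul, map_ofNat, map_one] using congrArg (algebraMap F K) M.three_mul_third

/-- The triple product is `X³ - (tr(X²)/3)X - (tr(X³)/3)1`. By Cayley–Hamilton `X³ = (tr(X²)/2)X +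
(det X)1`, the scalar parts cancel, and `1/2 - 1/3 = 1/6` explains the normalisation of the form. -/
theorem cube (X : M.carrier) : X * (X * X) = M.form X X • X := by
  refine Subtype.ext ?_
  rw [coe_mul, coe_mul, Submodule.coe_smul, ← algebraMap_smul K (M.form X X), algebraMap_form]
  have hX := M.trace_eq_zero _ X.2
  have h3 := two_smul_cube_of_trace_eq_zero X.1 hX
  have hh := M.two_mul_algebraMap_half
  have h3' := M.three_mul_algebraMap_third
  simp only [tracelessMul, ← algebraMap_smul K M.half, ← algebraMap_smul K M.third]
  generalize algebraMap F K M.half = h at *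
  generalize algebraMap F K M.third = t at *
  generalize X.1 = X at *
  have e1 : h • (X * X + X * X) = X * X := by
    rw [← two_smul K, smul_smul, mul_comm, hh, one_smul]
  have e2 : X * X * X = (h * (X * X).trace) • X + X.det • 1 := by
    have := congrArg (h • ·) h3
    simp only [smul_smul, mul_comm h 2, hh, one_smul, smul_add, ← mul_assoc, one_mul] at this
    exact this
  rw [e1]
  simp only [mul_sub, sub_mul, mul_smul_comm, smul_mul_assoc, mul_one, one_mul, trace_sub,
    trace_smul, hX, ← mul_assoc, e2]
  simp only [trace_add, trace_smul, hX, trace_one, smul_eq_mul, mul_zero, zero_add, sub_zero,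
    Fintype.card_fin]
  match_scalars
  · linear_combination h * (X * X).trace * hh - h * (X * X).trace * h3'
  · linear_combination X.det * hh - X.det * h3'

end TracelessModel

section RankOne

variable {K : Type*} [CommRing K] {v w : Fin 3 → K}

/-- Between the two copies of `v wᵀ` only the scalar `wᵀ X v` survives. -/
theorem vecMulVec_mul_mul_vecMulVec (X : Matrix (Fin 3) (Fin 3) K) :
    vecMulVec v w * X * vecMulVec v w = (vecMulVec v w * X).trace • vecMulVec v w := by
  ext i j
  simp [mul_apply, Fin.sum_univ_three, vecMulVec_apply, trace_fin_three]
  ring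

theorem trace_vecMulVec_eq_one (h : w ⬝ᵥ v = 1) : (vecMulVec v w).trace = 1 := by
  rw [trace_vecMulVec, dotProduct_comm, h]

theorem vecMulVec_mul_self (h : w ⬝ᵥ v = 1) : vecMulVec v w * vecMulVec v w = vecMulVec v w := by
  have e := vecMulVec_mul_mul_vecMulVec (v := v) (w := w) 1
  rwa [mul_one, trace_vecMulVec_eq_one h, one_smul] at e

theorem reflectionMatrix_mul_self (h : w ⬝ᵥ v = 1) :
    reflectionMatrix v w * reflectionMatrix v w = 1 := by
  rw [reflectionMatrix]
  simp only [mul_sub, sub_mul, smul_mul_assoc, mul_smul_comm, vecMulVec_mul_self h, mul_one,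
    one_mul]
  module

end RankOne

namespace TracelessModel

variable {F K : Type} [Field F] [CommRing K] [Algebra F K] (M : TracelessModel F K)
  {v w : Fin 3 → K}

/-- With `p = v wᵀ` one has `(2p-1)X(2p-1) = 4 tr(pX)p - 2(pX + Xp) + X`, which is the quadratic
formula for the Miyamoto involution of `3p - 1`. -/
theorem three_smul_reflection_conj (e X : M.carrier)
    (he : e.1 = axisMatrix v w) :
    (3 : F) • (reflectionMatrix v w * X.1 * reflectionMatrix v w) =
      (((8 * M.form e X) • e - (4 : F) • (e * X) - X : M.carrier) :
        Matrix (Fin 3) (Fin 3) K) := by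
  simp only [Submodule.coe_sub, Submodule.coe_smul, coe_mul]
  rw [← algebraMap_smul K (8 * M.form e X), map_mul, algebraMap_form, he,
    ← algebraMap_smul K (3 : F), ← algebraMap_smul K (4 : F)]
  have hX := M.trace_eq_zero _ X.2
  have hh := M.two_mul_algebraMap_half
  have h3' := M.three_mul_algebraMap_third
  simp only [tracelessMul, ← algebraMap_smul K M.half, ← algebraMap_smul K M.third, map_ofNat]
  generalize algebraMap F K M.half = h at *
  generalize algebraMap F K M.third = t at *
  generalize X.1 = X at *
  have hp := vecMulVec_mul_mul_vecMulVec (v := v) (w := w) X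
  simp only [axisMatrix, reflectionMatrix, sub_mul, mul_sub, one_mul, mul_one, smul_mul_assoc,
    mul_smul_comm, trace_sub, trace_smul, hX, hp, sub_zero, smul_eq_mul]
  generalize (vecMulVec v w * X).trace = s
  match_scalars
  · linear_combination -36 * s * t * hh - 12 * s * h3'
  · linear_combination 6 * hh
  · linear_combination 6 * hh
  · linear_combination -4 * hh
  · linear_combination 12 * t * s * hh

variable [Nontrivial K]

omit [Nontrivial K] in
theorem axis_mul_self (h : w ⬝ᵥ v = 1) (e : M.carrier) (he : e.1 = axisMatrix v w) :
    e * e = e := by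
  refine Subtype.ext ?_
  have hh := M.two_mul_algebraMap_half
  have h3' := M.three_mul_algebraMap_third
  rw [coe_mul, he, tracelessMul, ← algebraMap_smul K M.half, ← algebraMap_smul K M.third]
  generalize algebraMap F K M.half = x at *
  generalize algebraMap F K M.third = y at *
  simp only [axisMatrix, sub_mul, mul_sub, one_mul, mul_one, smul_mul_assoc,
    mul_smul_comm, trace_sub, trace_smul, trace_vecMulVec_eq_one h, vecMulVec_mul_self h,
    smul_eq_mul, trace_one, Fintype.card_fin]
  match_scalars
  · linear_combination 3 * hh
  · linear_combination hh - 2 * h3'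

theorem axis_ne_zero (h : w ⬝ᵥ v = 1) (e : M.carrier) (he : e.1 = axisMatrix v w) : e ≠ 0 := by
  rintro rfl
  have hh := M.two_mul_algebraMap_half
  have e1 := congrArg (· * vecMulVec v w) he
  simp only [axisMatrix, sub_mul, smul_mul_assoc, vecMulVec_mul_self h, one_mul,
    Submodule.coe_zero, zero_mul] at e1
  have e2 := congrArg trace e1
  rw [trace_zero, trace_sub, trace_smul, trace_vecMulVec_eq_one h, smul_eq_mul] at e2
  refine one_ne_zero (α := K) ?_
  linear_combination -hh - algebraMap F K M.half * e2

variable (a b c : M.carrier) {va wa vb wb vc wc : Fin 3 → K}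

/-- The eight products of `A, B, C` as matrices. -/
def matrixFamily (h t : F) (A B C : Matrix (Fin 3) (Fin 3) K) :
    Fin 8 → Matrix (Fin 3) (Fin 3) K :=
  ![A, B, C, tracelessMul h t A B, tracelessMul h t B C, tracelessMul h t A C,
    tracelessMul h t A (tracelessMul h t B C), tracelessMul h t B (tracelessMul h t A C)]

omit [Nontrivial K] in
theorem coe_spanningFamily (i : Fin 8) : (IsThreeGenerated.spanningFamily a b c i).1 =
    matrixFamily M.half M.third a.1 b.1 c.1 i := by
  fin_cases i <;> rfl

omit [Nontrivial K] in
-- `D` is a certificate: an inverse of the `8 × 8` matrix of coordinates.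
theorem linearIndependent_spanningFamily (D : Matrix (Fin 8) (Fin 8) F)
    (hD : D * Matrix.of (fun i => M.coord (matrixFamily M.half M.third a.1 b.1 c.1 i)) = 1) :
    LinearIndependent F (IsThreeGenerated.spanningFamily a b c) := by
  refine LinearIndependent.of_comp (M.coord ∘ₗ M.carrier.subtype) ?_
  have hu := linearIndependent_rows_of_isUnit (IsUnit.of_mul_eq_one_right _ hD)
  convert hu using 1
  ext i : 1
  exact congrArg M.coord (M.coe_spanningFamily a b c i)

omit [Nontrivial K] in
-- Injectivity of `coord` bounds the dimension by `8`. The result is used to see that the three axes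
-- generate the algebra.
theorem span_spanningFamily
    (hli : LinearIndependent F (IsThreeGenerated.spanningFamily a b c)) :
    Submodule.span F (Set.range (IsThreeGenerated.spanningFamily a b c)) = ⊤ := by
  have hinj : Function.Injective (M.coord ∘ₗ M.carrier.subtype) := by
    rw [injective_iff_map_eq_zero]
    exact fun X hX => Subtype.ext (M.coord_inj _ X.2 hX)
  have hfin : Module.Finite F M.carrier := Module.Finite.of_injective _ hinj
  have hle := LinearMap.finrank_le_finrank_of_injective hinj
  have hge := hli.fintype_card_le_finrank
  refine hli.span_eq_top_of_card_eq_finrank' (le_antisymm hge (hle.trans ?_))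
  simp

theorem isThreeGenerated (ha : wa ⬝ᵥ va = 1) (hb : wb ⬝ᵥ vb = 1) (hc : wc ⬝ᵥ vc = 1)
    (hva : a.1 = axisMatrix va wa) (hvb : b.1 = axisMatrix vb wb) (hvc : c.1 = axisMatrix vc wc)
    (hli : LinearIndependent F (IsThreeGenerated.spanningFamily a b c)) :
    IsThreeGenerated F M.form a b c (M.form a b) (M.form b c) (M.form a c)
      (M.form b (a * c)) := by
  have hs (X Y : M.carrier) : M.form X Y = M.form Y X := by
    rw [form_apply, form_apply, trace_mul_comm]
  have hp : IsPseudoComposition F M.form := by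
    -- If the form were zero, then `a = a(aa) = φ(a,a)a = 0`.
    refine ⟨hs, fun h0 => M.axis_ne_zero ha a hva ?_, M.cube⟩
    have e := M.cube a
    rwa [M.axis_mul_self ha a hva, M.axis_mul_self ha a hva, h0, LinearMap.zero_apply,
      LinearMap.zero_apply, zero_smul] at e
  refine ⟨hp, hp.isPrimitiveIdempotent M.two_ne_zero (M.axis_ne_zero ha a hva)
    (M.axis_mul_self ha a hva), hp.isPrimitiveIdempotent M.two_ne_zero (M.axis_ne_zero hb b hvb)
    (M.axis_mul_self hb b hvb), hp.isPrimitiveIdempotent M.two_ne_zero (M.axis_ne_zero hc c hvc)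
    (M.axis_mul_self hc c hvc), ?_, rfl, rfl, rfl, rfl⟩
  have hspan := M.span_spanningFamily a b c hli
  have h0 : a ∈ NonUnitalAlgebra.adjoin F {a, b, c} := NonUnitalAlgebra.subset_adjoin F (by simp)
  have h1 : b ∈ NonUnitalAlgebra.adjoin F {a, b, c} := NonUnitalAlgebra.subset_adjoin F (by simp)
  have h2 : c ∈ NonUnitalAlgebra.adjoin F {a, b, c} := NonUnitalAlgebra.subset_adjoin F (by simp)
  have hle : (⊤ : Submodule F M.carrier) ≤ (NonUnitalAlgebra.adjoin F {a, b, c}).toSubmodule := by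
    rw [← hspan, Submodule.span_le]
    rintro _ ⟨i, rfl⟩
    have hm {x y : M.carrier} : x ∈ NonUnitalAlgebra.adjoin F {a, b, c} →
        y ∈ NonUnitalAlgebra.adjoin F {a, b, c} → x * y ∈ NonUnitalAlgebra.adjoin F {a, b, c} :=
      MulMemClass.mul_mem
    fin_cases i
    exacts [h0, h1, h2, hm h0 h1, hm h1 h2, hm h0 h2, hm h0 (hm h1 h2), hm h1 (hm h0 h2)]
  exact eq_top_iff.2 fun x _ => hle (Submodule.mem_top (x := x))

section Action

variable {G : Type*} [Group G] (ι : G →* Matrix (Fin 3) (Fin 3) K)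
  (hι : ∀ g, ∀ X ∈ M.carrier, ι g * X * ι g⁻¹ ∈ M.carrier)

omit [Nontrivial K] in
theorem coe_mul_coe_inv (g : G) : ι g * ι g⁻¹ = 1 := by
  rw [← map_mul, mul_inv_cancel, map_one]

omit [Nontrivial K] in
theorem coe_inv_mul_coe (g : G) : ι g⁻¹ * ι g = 1 := by
  rw [← map_mul, inv_mul_cancel, map_one]

/-- The action of a group of matrices by conjugation. -/
def conjRep : G →* (M.carrier ≃ₗ[F] M.carrier) where
  toFun g :=
    { toFun X := ⟨ι g * X.1 * ι g⁻¹, hι g X.1 X.2⟩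
      invFun X := ⟨ι g⁻¹ * X.1 * ι g, by simpa using hι g⁻¹ X.1 X.2⟩
      map_add' X Y := Subtype.ext (by simp [mul_add, add_mul])
      map_smul' r X := Subtype.ext (by simp)
      left_inv X := Subtype.ext (by
        simp only [← mul_assoc, coe_inv_mul_coe, one_mul]
        rw [mul_assoc, coe_inv_mul_coe, mul_one])
      right_inv X := Subtype.ext (by
        simp only [← mul_assoc, coe_mul_coe_inv, one_mul]
        rw [mul_assoc, coe_mul_coe_inv, mul_one]) }
  map_one' := by
    ext X : 2
    simp
  map_mul' g k := by
    ext X : 2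
    simp [mul_assoc]

omit [Nontrivial K] in
theorem coe_conjRep (g : G) (X : M.carrier) :
    (M.conjRep ι hι g X).1 = ι g * X.1 * ι g⁻¹ := rfl

omit [Nontrivial K] in
theorem conjRep_mul (g : G) (X Y : M.carrier) :
    M.conjRep ι hι g (X * Y) = M.conjRep ι hι g X * M.conjRep ι hι g Y := by
  have hm (X Y : Matrix (Fin 3) (Fin 3) K) : ι g * X * ι g⁻¹ * (ι g * Y * ι g⁻¹) =
      ι g * (X * Y) * ι g⁻¹ := by
    simp only [mul_assoc]
    rw [← mul_assoc (ι g⁻¹) (ι g), coe_inv_mul_coe, one_mul]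
  refine Subtype.ext ?_
  simp only [coe_conjRep, coe_mul, tracelessMul]
  rw [hm, hm, trace_mul_comm (ι g * (X.1 * Y.1)), ← mul_assoc (ι g⁻¹), coe_inv_mul_coe, one_mul]
  simp only [mul_sub, sub_mul, mul_smul_comm, smul_mul_assoc, mul_add, add_mul, mul_one,
    coe_mul_coe_inv]

omit [Nontrivial K] in
-- Both sides say that `g` commutes with `p`, because `3p - 1` and `2p - 1` each determine `p`.
theorem conjRep_eq_self_iff (hinj : Function.Injective ι) {r : G}
    (hr : ι r = reflectionMatrix v w) (e : M.carrier) (he : e.1 = axisMatrix v w) (g : G) :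
    M.conjRep ι hι g e = e ↔ g * r = r * g := by
  have hh := M.two_mul_algebraMap_half
  have h3 := M.three_mul_algebraMap_third
  have k1 : g * r = r * g ↔ ι g * reflectionMatrix v w = reflectionMatrix v w * ι g := by
    rw [← hr, ← map_mul, ← map_mul, hinj.eq_iff]
  have k2 : M.conjRep ι hι g e = e ↔ ι g * axisMatrix v w = axisMatrix v w * ι g := by
    rw [Subtype.ext_iff, coe_conjRep, he]
    constructor
    · intro h
      have h' := congrArg (· * ι g) h
      simpa only [mul_assoc, coe_inv_mul_coe, mul_one] using h'
    · intro h
      rw [h, mul_assoc, coe_mul_coe_inv, mul_one]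
  rw [k1, k2]
  simp only [axisMatrix, reflectionMatrix, mul_sub, sub_mul, mul_one, one_mul, mul_smul_comm,
    smul_mul_assoc, sub_left_inj]
  constructor
  · intro h
    have h' := congrArg (algebraMap F K M.third • ·) h
    simp only [smul_smul, mul_comm _ (3 : K), h3, one_smul] at h'
    rw [h']
  · intro h
    have h' := congrArg (algebraMap F K M.half • ·) h
    simp only [smul_smul, mul_comm _ (2 : K), hh, one_smul] at h'
    rw [h']

theorem isMiyamotoInvolution_conjRep (hp : IsPseudoComposition F M.form) (h : w ⬝ᵥ v = 1) {r : G}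
    (hr : ι r = reflectionMatrix v w) (e : M.carrier) (he : e.1 = axisMatrix v w) :
    IsMiyamotoInvolution F e (M.conjRep ι hι r) := by
  refine hp.isMiyamotoInvolution_of_apply M.two_ne_zero M.three_ne_zero (M.axis_ne_zero h e he)
    (M.axis_mul_self h e he) fun X => Subtype.ext ?_
  have hri : ι r⁻¹ = reflectionMatrix v w := by
    have e1 := coe_inv_mul_coe ι r
    rw [hr] at e1
    rw [← mul_one (ι r⁻¹), ← reflectionMatrix_mul_self h, ← mul_assoc, e1, one_mul]
  rw [Submodule.coe_smul, coe_conjRep, hr, hri, M.three_smul_reflection_conj e X he]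

include hι in
theorem universalMiyamotoGroupIso (hinj : Function.Injective ι) {ra rb rc : G}
    (hG : Subgroup.closure {ra, rb, rc} = ⊤)
    (ha : wa ⬝ᵥ va = 1) (hb : wb ⬝ᵥ vb = 1) (hc : wc ⬝ᵥ vc = 1)
    (hra : ι ra = reflectionMatrix va wa) (hrb : ι rb = reflectionMatrix vb wb)
    (hrc : ι rc = reflectionMatrix vc wc)
    (hva : a.1 = axisMatrix va wa) (hvb : b.1 = axisMatrix vb wb) (hvc : c.1 = axisMatrix vc wc)
    (D : Matrix (Fin 8) (Fin 8) F)
    (hD : D * Matrix.of (fun i => M.coord (matrixFamily M.half M.third a.1 b.1 c.1 i)) = 1) :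
    UniversalMiyamotoGroupIso.{u} F (M.form a b) (M.form b c) (M.form a c) (M.form b (a * c))
      (G ⧸ Subgroup.center G) := by
  have hli := M.linearIndependent_spanningFamily a b c D hD
  have H := M.isThreeGenerated a b c ha hb hc hva hvb hvc hli
  exact universalMiyamotoGroupIso_of_model M.two_ne_zero M.three_ne_zero H hli (M.conjRep ι hι)
    (M.conjRep_mul ι hι) hG
    (M.isMiyamotoInvolution_conjRep ι hι H.pseudoComposition ha hra a hva)
    (M.isMiyamotoInvolution_conjRep ι hι H.pseudoComposition hb hrb b hvb)
    (M.isMiyamotoInvolution_conjRep ι hι H.pseudoComposition hc hrc c hvc)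
    (M.conjRep_eq_self_iff ι hι hinj hra a hva) (M.conjRep_eq_self_iff ι hι hinj hrb b hvb)
    (M.conjRep_eq_self_iff ι hι hinj hrc c hvc)

end Action

end TracelessModel

/-! ### Matrices of a subgroup; unitriangular matrices. -/

section Image

variable {K : Type} [CommRing K] {G : Type*} [Group G] (ι : G →* Matrix (Fin 3) (Fin 3) K)

/-- The matrices of the elements of a subgroup. -/
def matrixImage (H : Subgroup G) : Submonoid (Matrix (Fin 3) (Fin 3) K) := H.toSubmonoid.map ι

variable {ι} {H : Subgroup G}

theorem matrixImage_of_mul_eq_one {M N : Matrix (Fin 3) (Fin 3) K} (hM : M ∈ matrixImage ι H)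
    (h : M * N = 1) : N ∈ matrixImage ι H := by
  obtain ⟨g, hg, rfl⟩ := hM
  refine ⟨g⁻¹, H.inv_mem hg, ?_⟩
  rw [← mul_one (ι g⁻¹), ← h, ← mul_assoc, ← map_mul, inv_mul_cancel, map_one, one_mul]

theorem eq_top_of_forall_mem_matrixImage (hinj : Function.Injective ι)
    (h : ∀ g, ι g ∈ matrixImage ι H) : H = ⊤ := by
  rw [eq_top_iff]
  intro g _
  obtain ⟨k, hk, e⟩ := h g
  rwa [← hinj e]

theorem list_prod_mem_matrixImage_closure {r : Fin 3 → Matrix (Fin 3) (Fin 3) K} {g : Fin 3 → G}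
    (hr : ∀ i, ι (g i) = r i) (l : List (Fin 3)) :
    (l.map r).prod ∈ matrixImage ι (Subgroup.closure {g 0, g 1, g 2}) := by
  refine Submonoid.list_prod_mem _ fun M hM => ?_
  obtain ⟨i, -, rfl⟩ := List.mem_map.1 hM
  refine ⟨g i, Subgroup.subset_closure ?_, hr i⟩
  fin_cases i <;> simp

end Image

/-- The matrix with entries `-1` on the antidiagonal and `0` elsewhere. -/
def negAntidiag (K : Type*) [CommRing K] : Matrix (Fin 3) (Fin 3) K :=
  !![0, 0, -1; 0, -1, 0; -1, 0, 0]

/-- Upper unitriangular matrices. -/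
def unitri {K : Type*} [CommRing K] (a b c : K) : Matrix (Fin 3) (Fin 3) K :=
  !![1, a, b; 0, 1, c; 0, 0, 1]

theorem unitri_mul {K : Type*} [CommRing K] (a b c a' b' c' : K) :
    unitri a b c * unitri a' b' c' = unitri (a + a') (b + b' + a * c') (c + c') := by
  ext i j
  fin_cases i <;> fin_cases j <;> simp [unitri, mul_apply, Fin.sum_univ_three] <;> ring

theorem unitri_zero {K : Type*} [CommRing K] : unitri (0 : K) 0 0 = 1 := by
  ext i j
  fin_cases i <;> fin_cases j <;> simp [unitri]

theorem negAntidiag_mul_unitri {K : Type*} [CommRing K] (a b c : K) :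
    negAntidiag K * unitri a b c * negAntidiag K = !![1, 0, 0; c, 1, 0; b, a, 1] := by
  ext i j
  fin_cases i <;> fin_cases j <;> simp [unitri, negAntidiag, mul_apply, Fin.sum_univ_three]

section UnitriMem

variable {K : Type} [CommRing K] {G : Type*} [Group G] {ι : G →* Matrix (Fin 3) (Fin 3) K}
  {H : Subgroup G}

theorem unitri_neg_mem {a b c : K} (h : unitri a b c ∈ matrixImage ι H) :
    unitri (-a) (a * c - b) (-c) ∈ matrixImage ι H := by
  refine matrixImage_of_mul_eq_one h ?_
  rw [unitri_mul, ← unitri_zero]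
  congr 1 <;> ring

/-- The group commutator of two unitriangular matrices, which lies in the centre of the Heisenberg
group. -/
theorem unitri_commutator_mem {a b c a' b' c' : K} (h : unitri a b c ∈ matrixImage ι H)
    (h' : unitri a' b' c' ∈ matrixImage ι H) : unitri 0 (a * c' - a' * c) 0 ∈ matrixImage ι H := by
  have e := mul_mem (mul_mem h h') (mul_mem (unitri_neg_mem h) (unitri_neg_mem h'))
  simp only [unitri_mul] at e
  convert e using 2 <;> ring

end UnitriMem

/-! ### Generating `SL(3, p)`. -/

section SpecialLinear

variable {p : ℕ} [Fact p.Prime] {G : Type*} [Group G]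
  {ι : G →* Matrix (Fin 3) (Fin 3) (ZMod p)} {H : Subgroup G}

/-- Over a prime field additive subgroups are subspaces. The central entries obtained form a
subspace of the line containing a non-zero commutator, and the superdiagonals obtained form a
subspace of the plane containing two independent vectors; both are everything. -/
theorem unitri_mem_of_independent {a b c a' b' c' : ZMod p}
    (h : unitri a b c ∈ matrixImage ι H) (h' : unitri a' b' c' ∈ matrixImage ι H)
    (hne : a * c' - a' * c ≠ 0) (x y z : ZMod p) : unitri x y z ∈ matrixImage ι H := by
  let Z : AddSubgroup (ZMod p) :=
    { carrier := {y | unitri 0 y 0 ∈ matrixImage ι H}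
      zero_mem' := by
        rw [Set.mem_ofPred_eq, unitri_zero]
        exact one_mem _
      add_mem' {y y'} hy hy' := by
        have e := mul_mem (Set.mem_ofPred_eq ▸ hy) (Set.mem_ofPred_eq ▸ hy')
        rw [unitri_mul] at e
        simpa using e
      neg_mem' {y} hy := by
        have e := unitri_neg_mem hy
        simpa using e }
  have hZ (y : ZMod p) : unitri 0 y 0 ∈ matrixImage ι H := by
    have e := (AddSubgroup.toZModSubmodule p Z).smul_mem (y * (a * c' - a' * c)⁻¹)
      (unitri_commutator_mem h h')
    rw [smul_eq_mul, inv_mul_cancel_right₀ hne] at e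
    exact e
  let P : AddSubgroup (ZMod p × ZMod p) :=
    { carrier := {q | ∃ y, unitri q.1 y q.2 ∈ matrixImage ι H}
      zero_mem' := ⟨0, hZ 0⟩
      add_mem' := by
        rintro q q' ⟨y, hy⟩ ⟨y', hy'⟩
        have e := mul_mem hy hy'
        rw [unitri_mul] at e
        exact ⟨_, e⟩
      neg_mem' := by
        rintro q ⟨y, hy⟩
        exact ⟨_, unitri_neg_mem hy⟩ }
  have hP : (x, z) ∈ AddSubgroup.toZModSubmodule p P := by
    have e := add_mem
      ((AddSubgroup.toZModSubmodule p P).smul_mem ((x * c' - z * a') * (a * c' - a' * c)⁻¹)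
        (show (a, c) ∈ AddSubgroup.toZModSubmodule p P from ⟨b, h⟩))
      ((AddSubgroup.toZModSubmodule p P).smul_mem ((z * a - x * c) * (a * c' - a' * c)⁻¹)
        (show (a', c') ∈ AddSubgroup.toZModSubmodule p P from ⟨b', h'⟩))
    convert e using 1
    have hd := mul_inv_cancel₀ hne
    ext
    · simp only [Prod.smul_mk, smul_eq_mul, Prod.mk_add_mk]
      linear_combination -x * hd
    · simp only [Prod.smul_mk, smul_eq_mul, Prod.mk_add_mk]
      linear_combination -z * hd
  obtain ⟨y', hy'⟩ := hP
  have e := mul_mem hy' (hZ (y - y'))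
  rw [unitri_mul] at e
  simpa using e

/-- Conjugation by `negAntidiag` provides the lower unitriangular matrices, hence all transvections
and the diagonal matrices of determinant one; Gaussian elimination finishes. -/
theorem eq_top_of_unitri_mem_of_det_eq_one (hinj : Function.Injective ι)
    (hdet : ∀ g, (ι g).det = 1) (hJ : negAntidiag (ZMod p) ∈ matrixImage ι H)
    {a b c a' b' c' : ZMod p} (h : unitri a b c ∈ matrixImage ι H)
    (h' : unitri a' b' c' ∈ matrixImage ι H) (hne : a * c' - a' * c ≠ 0) : H = ⊤ := by
  have hU := unitri_mem_of_independent h h' hne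
  have hL (x y z : ZMod p) : !![1, 0, 0; z, 1, 0; y, x, 1] ∈ matrixImage ι H := by
    rw [← negAntidiag_mul_unitri]
    exact mul_mem (mul_mem hJ (hU x y z)) hJ
  have hD1 (t : ZMod p) (ht : t ≠ 0) :
      !![t, 0, 0; 0, t⁻¹, 0; 0, 0, 1] ∈ matrixImage ι H := by
    -- The identity `w(t) w(-1) = diag(t, t⁻¹)` in `SL(2)`, where `w(t) = x(t) y(-t⁻¹) x(t)` with
    -- `x` upper and `y` lower unitriangular.
    have e := mul_mem (mul_mem (mul_mem (hU t 0 0) (hL 0 0 (-t⁻¹))) (hU t 0 0))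
      (mul_mem (mul_mem (hU (-1) 0 0) (hL 0 0 1)) (hU (-1) 0 0))
    convert e using 1
    ext i j
    fin_cases i <;> fin_cases j <;> simp [unitri, mul_apply, Fin.sum_univ_three, ht]
  have hD2 (t : ZMod p) (ht : t ≠ 0) :
      !![1, 0, 0; 0, t, 0; 0, 0, t⁻¹] ∈ matrixImage ι H := by
    have e := mul_mem (mul_mem (mul_mem (hU 0 0 t) (hL (-t⁻¹) 0 0)) (hU 0 0 t))
      (mul_mem (mul_mem (hU 0 0 (-1)) (hL 1 0 0)) (hU 0 0 (-1)))
    convert e using 1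
    ext i j
    fin_cases i <;> fin_cases j <;> simp [unitri, mul_apply, Fin.sum_univ_three, ht]
  refine eq_top_of_forall_mem_matrixImage hinj fun g => ?_
  refine diagonal_transvection_induction (· ∈ matrixImage ι H) (ι g) (fun D hD => ?_)
    (fun t => ?_) fun A B => mul_mem
  · rw [hdet, det_diagonal, Fin.prod_univ_three] at hD
    have h0 : D 0 ≠ 0 := fun h0 => by simp [h0] at hD
    have h1 : D 1 ≠ 0 := fun h0 => by simp [h0] at hD
    have h2 : D 2 = (D 0 * D 1)⁻¹ := eq_inv_of_mul_eq_one_right hD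
    convert mul_mem (hD1 (D 0) h0) (hD2 (D 0 * D 1) (mul_ne_zero h0 h1)) using 1
    ext i j
    fin_cases i <;> fin_cases j <;>
      simp [mul_apply, Fin.sum_univ_three, h2, h0]
  · obtain ⟨i, j, hij, s⟩ := t
    have key {M : Matrix (Fin 3) (Fin 3) (ZMod p)} (hM : M ∈ matrixImage ι H)
        (e : transvection i j s = M) :
        (⟨i, j, hij, s⟩ : TransvectionStruct (Fin 3) (ZMod p)).toMatrix ∈ matrixImage ι H := by
      rwa [TransvectionStruct.toMatrix_mk, e]
    fin_cases i <;> fin_cases j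
    · exact absurd rfl hij
    · refine key (hU s 0 0) (ext fun k l => ?_)
      fin_cases k <;> fin_cases l <;> simp [transvection, unitri]
    · refine key (hU 0 s 0) (ext fun k l => ?_)
      fin_cases k <;> fin_cases l <;> simp [transvection, unitri]
    · refine key (hL 0 0 s) (ext fun k l => ?_)
      fin_cases k <;> fin_cases l <;> simp [transvection]
    · exact absurd rfl hij
    · refine key (hU 0 0 s) (ext fun k l => ?_)
      fin_cases k <;> fin_cases l <;> simp [transvection, unitri]
    · refine key (hL 0 s 0) (ext fun k l => ?_)
      fin_cases k <;> fin_cases l <;> simp [transvection]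
    · refine key (hL s 0 0) (ext fun k l => ?_)
      fin_cases k <;> fin_cases l <;> simp [transvection]
    · exact absurd rfl hij

end SpecialLinear

/-! ### The split case: `PSL(3, p)`. -/

/-- Special linear matrices as a monoid of matrices. -/
def specialLinearCoe (K : Type) [CommRing K] : SL(3, K) →* Matrix (Fin 3) (Fin 3) K where
  toFun g := g
  map_one' := rfl
  map_mul' _ _ := rfl

theorem specialLinearCoe_injective (K : Type) [CommRing K] :
    Function.Injective (specialLinearCoe K) := fun _ _ h => Subtype.ext h

theorem trace_axisMatrix {K : Type} [CommRing K] {v w : Fin 3 → K} (h : w ⬝ᵥ v = 1) :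
    (axisMatrix v w).trace = 0 := by
  rw [axisMatrix, trace_sub, trace_smul, trace_vecMulVec_eq_one h]
  simp

theorem det_reflectionMatrix {K : Type} [CommRing K] {v w : Fin 3 → K} (h : w ⬝ᵥ v = 1) :
    (reflectionMatrix v w).det = 1 := by
  simp only [dotProduct, Fin.sum_univ_three] at h
  simp [reflectionMatrix, det_fin_three, vecMulVec_apply]
  linear_combination 2 * h

theorem trace_tracelessMul {F K : Type} [Field F] [CommRing K] [Algebra F K] {h t : F}
    (hh : 2 * h = 1) (ht : 3 * t = 1) (X Y : Matrix (Fin 3) (Fin 3) K) :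
    (tracelessMul h t X Y).trace = 0 := by
  have hh' := congrArg (algebraMap F K) hh
  have ht' := congrArg (algebraMap F K) ht
  simp only [map_mul, map_ofNat, map_one] at hh' ht'
  rw [tracelessMul, trace_sub, trace_smul, trace_smul, trace_smul, trace_add, trace_mul_comm Y,
    trace_one, Algebra.smul_def, Algebra.smul_def, smul_eq_mul, Fintype.card_fin]
  push_cast
  linear_combination (X * Y).trace * hh' - (X * Y).trace * ht'

/-- All traceless matrices over a field. -/
def specialLinearModel (F : Type) [Field F] (h t : F) (hh : 2 * h = 1) (ht : 3 * t = 1) :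
    TracelessModel F F where
  half := h
  third := t
  two_mul_half := hh
  three_mul_third := ht
  carrier := LinearMap.ker (traceLinearMap (Fin 3) F F)
  re := LinearMap.id
  trace_eq_zero _ hX := hX
  mul_mem X _ Y _ := trace_tracelessMul hh ht X Y
  trace_mul _ _ _ _ := rfl
  coord :=
    { toFun X := ![X 0 0, X 0 1, X 0 2, X 1 0, X 1 1, X 1 2, X 2 0, X 2 1]
      map_add' X Y := by simp
      map_smul' r X := by simp }
  coord_inj X hX h := by
    have hX' : X.trace = 0 := hX
    have k (i : Fin 8) := congrFun h i
    have k0 : X 0 0 = 0 := k 0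
    have k1 : X 0 1 = 0 := k 1
    have k2 : X 0 2 = 0 := k 2
    have k3 : X 1 0 = 0 := k 3
    have k4 : X 1 1 = 0 := k 4
    have k5 : X 1 2 = 0 := k 5
    have k6 : X 2 0 = 0 := k 6
    have k7 : X 2 1 = 0 := k 7
    have k8 : X 2 2 = 0 := by simpa [trace_fin_three, k0, k4] using hX'
    ext i j
    fin_cases i <;> fin_cases j <;> assumption

/-- Reduces a case to finite data: three rank one projections with the right form values, two words
`l`, `l'` in the reflections that are unitriangular with independent superdiagonals, and the inverse
`D` of the coordinate matrix. -/
theorem universalMiyamotoGroupIso_PSL {p : ℕ} [Fact p.Prime] {α β γ ψ h t : ZMod p}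
    (hh : 2 * h = 1) (ht : 3 * t = 1) (va wa vb wb vc wc : Fin 3 → ZMod p)
    (ha : wa ⬝ᵥ va = 1) (hb : wb ⬝ᵥ vb = 1) (hc : wc ⬝ᵥ vc = 1)
    (hα : h * t * (axisMatrix va wa * axisMatrix vb wb).trace = α)
    (hβ : h * t * (axisMatrix vb wb * axisMatrix vc wc).trace = β)
    (hγ : h * t * (axisMatrix va wa * axisMatrix vc wc).trace = γ)
    (hψ : h * t * (axisMatrix vb wb *
      tracelessMul h t (axisMatrix va wa) (axisMatrix vc wc)).trace = ψ)
    (hJ : reflectionMatrix va wa = negAntidiag (ZMod p))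
    (l l' : List (Fin 3)) (x y z x' y' z' : ZMod p)
    (hl : (l.map ![reflectionMatrix va wa, reflectionMatrix vb wb,
      reflectionMatrix vc wc]).prod = unitri x y z)
    (hl' : (l'.map ![reflectionMatrix va wa, reflectionMatrix vb wb,
      reflectionMatrix vc wc]).prod = unitri x' y' z')
    (hne : x * z' - x' * z ≠ 0) (D : Matrix (Fin 8) (Fin 8) (ZMod p))
    (hD : D * Matrix.of (fun i => (specialLinearModel (ZMod p) h t hh ht).coord
      (TracelessModel.matrixFamily h t (axisMatrix va wa) (axisMatrix vb wb) (axisMatrix vc wc) i)) = 1) :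
    UniversalMiyamotoGroupIso.{u} (ZMod p) α β γ ψ PSL(3, ZMod p) := by
  let M := specialLinearModel (ZMod p) h t hh ht
  let g : Fin 3 → SL(3, ZMod p) := ![⟨_, det_reflectionMatrix ha⟩, ⟨_, det_reflectionMatrix hb⟩,
    ⟨_, det_reflectionMatrix hc⟩]
  have hr (i) : specialLinearCoe (ZMod p) (g i) =
      ![reflectionMatrix va wa, reflectionMatrix vb wb, reflectionMatrix vc wc] i := by
    fin_cases i <;> rfl
  have hG : Subgroup.closure {g 0, g 1, g 2} = ⊤ := by
    refine eq_top_of_unitri_mem_of_det_eq_one (specialLinearCoe_injective (ZMod p))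
      (fun g => g.2) ?_ (hl ▸ list_prod_mem_matrixImage_closure hr l)
      (hl' ▸ list_prod_mem_matrixImage_closure hr l') hne
    exact ⟨g 0, Subgroup.subset_closure (by simp), hJ⟩
  have key := M.universalMiyamotoGroupIso.{u} ⟨_, trace_axisMatrix ha⟩ ⟨_, trace_axisMatrix hb⟩
    ⟨_, trace_axisMatrix hc⟩ (specialLinearCoe (ZMod p)) (fun g X hX => ?_)
    (specialLinearCoe_injective (ZMod p)) hG ha hb hc (hr 0) (hr 1) (hr 2) rfl rfl rfl D hD
  · subst hα hβ hγ hψ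
    exact key
  · change (_ : Matrix (Fin 3) (Fin 3) (ZMod p)).trace = 0
    rw [trace_mul_comm, ← mul_assoc, ← map_mul, inv_mul_cancel, map_one, one_mul]
    exact hX

theorem universalMiyamotoGroupIso_PSL_seven :
    UniversalMiyamotoGroupIso.{u} (ZMod 7) 6 2 1 5 PSL(3, ZMod 7) :=
  universalMiyamotoGroupIso_PSL (h := 4) (t := 5) (by decide +kernel) (by decide +kernel)
    -- The first axis has `v = (1, 0, -1)` and `w = v/2`, which makes its reflection equal to
    -- `negAntidiag`. The same choice is made for every `p`.
    ![1, 0, 6] ![4, 0, 3] ![0, 0, 4] ![1, 1, 2] ![3, 1, 6] ![1, 2, 4]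
    (by decide +kernel) (by decide +kernel) (by decide +kernel) (by decide +kernel) (by decide +kernel)
    (by decide +kernel) (by decide +kernel) (by decide +kernel)
    [0, 1, 0, 2, 0, 2, 0, 1, 0, 2, 0, 2]
    [2, 0, 2, 0, 2, 1, 2, 0, 2, 0, 2, 0, 2, 1, 2, 0]
    4 3 0 0 3 5
    (by decide +kernel) (by decide +kernel) (by decide +kernel)
    !![3, 5, 1, 3, 3, 2, 5, 4;
      3, 1, 0, 6, 4, 3, 4, 3;
      0, 1, 2, 6, 5, 3, 2, 0;
      0, 6, 3, 2, 5, 1, 4, 1;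
      5, 4, 5, 2, 2, 6, 5, 2;
      3, 1, 2, 5, 3, 3, 1, 6;
      4, 5, 2, 3, 4, 3, 1, 0;
      6, 4, 2, 5, 4, 0, 1, 4]
    (by decide +kernel)

theorem universalMiyamotoGroupIso_PSL_eleven :
    UniversalMiyamotoGroupIso.{u} (ZMod 11) 1 1 3 0 PSL(3, ZMod 11) :=
  universalMiyamotoGroupIso_PSL (h := 6) (t := 4) (by decide +kernel) (by decide +kernel)
    ![1, 0, 10] ![6, 0, 5] ![0, 0, 10] ![1, 8, 10] ![0, 3, 6] ![1, 9, 3]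
    (by decide +kernel) (by decide +kernel) (by decide +kernel) (by decide +kernel) (by decide +kernel)
    (by decide +kernel) (by decide +kernel) (by decide +kernel)
    [1, 0, 1, 2, 1, 0, 2, 1, 2, 1]
    [0, 1, 0, 1, 2, 1, 2, 1, 0, 1, 0, 1, 2, 1, 2, 1]
    6 9 6 10 7 0
    (by decide +kernel) (by decide +kernel) (by decide +kernel)
    !![1, 7, 10, 4, 7, 2, 8, 2;
      1, 3, 4, 4, 9, 9, 7, 7;
      1, 1, 9, 1, 6, 0, 8, 0;
      0, 2, 7, 8, 1, 8, 6, 0;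
      9, 9, 7, 2, 0, 8, 0, 1;
      5, 5, 7, 0, 3, 8, 8, 0;
      0, 10, 8, 10, 0, 10, 2, 0;
      6, 4, 7, 4, 2, 2, 4, 4]
    (by decide +kernel)

theorem universalMiyamotoGroupIso_PSL_thirteen :
    UniversalMiyamotoGroupIso.{u} (ZMod 13) 8 10 4 2 PSL(3, ZMod 13) :=
  universalMiyamotoGroupIso_PSL (h := 7) (t := 9) (by decide +kernel) (by decide +kernel)
    ![1, 0, 12] ![7, 0, 6] ![0, 2, 7] ![1, 0, 2] ![11, 6, 0] ![1, 7, 4]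
    (by decide +kernel) (by decide +kernel) (by decide +kernel) (by decide +kernel) (by decide +kernel)
    (by decide +kernel) (by decide +kernel) (by decide +kernel)
    [1, 2, 1, 0, 1, 2, 0, 2, 1, 2, 0, 2, 1, 2, 0, 1]
    [2, 1, 0, 2, 0, 1, 0, 2, 0, 1, 2, 1, 2, 0, 1, 0, 2, 1]
    6 1 9 7 5 7
    (by decide +kernel) (by decide +kernel) (by decide +kernel)
    !![6, 1, 5, 9, 8, 9, 6, 9;
      8, 11, 0, 6, 1, 1, 7, 7;
      0, 3, 6, 8, 9, 9, 7, 7;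
      9, 3, 7, 8, 12, 2, 0, 9;
      5, 0, 6, 12, 5, 4, 1, 11;
      1, 12, 12, 1, 12, 12, 4, 4;
      11, 6, 9, 0, 12, 0, 3, 6;
      6, 9, 12, 6, 6, 1, 5, 6]
    (by decide +kernel)

/-! ### Generating the special unitary group. -/

/-- Matrices of determinant one preserving the antidiagonal Hermitian form. -/
structure IsSpecialUnitary {K : Type} [CommRing K] [StarRing K] (M : Matrix (Fin 3) (Fin 3) K) :
    Prop where
  det : M.det = 1
  unitary : M * negAntidiag K * Mᴴ = negAntidiag K

section Unitary

theorem negAntidiag_mul_self (K : Type) [CommRing K] : negAntidiag K * negAntidiag K = 1 := by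
  ext i j
  fin_cases i <;> fin_cases j <;> simp [negAntidiag, mul_apply, Fin.sum_univ_three]

theorem mul_negAntidiag_mul_conjTranspose_apply {K : Type} [CommRing K] [StarRing K]
    (M : Matrix (Fin 3) (Fin 3) K) (i j : Fin 3) : (M * negAntidiag K * Mᴴ) i j =
      -(M i 0 * star (M j 2) + M i 1 * star (M j 1) + M i 2 * star (M j 0)) := by
  simp [negAntidiag, mul_apply, Fin.sum_univ_three]
  ring

namespace IsSpecialUnitary

variable {K : Type} [Field K] [StarRing K] {M N : Matrix (Fin 3) (Fin 3) K}

theorem mul (hM : IsSpecialUnitary M) (hN : IsSpecialUnitary N) : IsSpecialUnitary (M * N) := by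
  refine ⟨by rw [det_mul, hM.det, hN.det, one_mul], ?_⟩
  calc M * N * negAntidiag K * (M * N)ᴴ = M * (N * negAntidiag K * Nᴴ) * Mᴴ := by
        rw [conjTranspose_mul]
        simp only [Matrix.mul_assoc]
    _ = negAntidiag K := by rw [hN.unitary, hM.unitary]

theorem row (hM : IsSpecialUnitary M) (i j : Fin 3) :
    M i 0 * star (M j 2) + M i 1 * star (M j 1) + M i 2 * star (M j 0) =
      -negAntidiag K i j := by
  rw [← hM.unitary, mul_negAntidiag_mul_conjTranspose_apply, neg_neg]

/-- Unitarity exhibits a right inverse of `M`; as it is also a left inverse, the relations between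
rows become relations between columns. -/
theorem column_isotropic (hM : IsSpecialUnitary M) :
    M 0 0 * star (M 2 0) + M 1 0 * star (M 1 0) + M 2 0 * star (M 0 0) = 0 := by
  have e : M * (negAntidiag K * Mᴴ * negAntidiag K) = 1 := by
    rw [← Matrix.mul_assoc, ← Matrix.mul_assoc, hM.unitary, negAntidiag_mul_self]
  rw [mul_eq_one_comm] at e
  have e1 := congrFun (congrFun e 2) 0
  simp only [mul_apply, Fin.sum_univ_three] at e1
  simp [negAntidiag] at e1
  linear_combination e1

end IsSpecialUnitary

theorem isSpecialUnitary_unitri_iff {K : Type} [Field K] [StarRing K] {a b c : K} :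
    IsSpecialUnitary (unitri a b c) ↔ c = -star a ∧ b + star b + a * star a = 0 := by
  constructor
  · intro h
    have h0 := h.row 0 0
    have h1 := h.row 1 0
    simp [unitri, negAntidiag] at h0 h1
    exact ⟨by linear_combination h1, by linear_combination h0⟩
  · rintro ⟨rfl, h⟩
    refine ⟨by simp [unitri, det_fin_three], ?_⟩
    ext i j
    rw [mul_negAntidiag_mul_conjTranspose_apply]
    fin_cases i <;> fin_cases j <;> simp [unitri, negAntidiag]
    linear_combination -h

end Unitary

section SpecialUnitary

variable {p : ℕ} [Fact p.Prime] {d : ZMod p} [Fact (∀ r : ZMod p, r ^ 2 ≠ d + 0 * r)]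
  {G : Type*} [Group G] {ι : G →* Matrix (Fin 3) (Fin 3) (QuadraticAlgebra (ZMod p) d 0)}
  {H : Subgroup G}

/-- The analogue of `unitri_mem_of_independent`. The central entries now have real part zero and
form a line over `𝔽_p`; the entry `a` ranges over a plane over `𝔽_p`. -/
theorem unitri_mem_of_isSpecialUnitary (h2 : (2 : ZMod p) ≠ 0)
    (hι : ∀ g, IsSpecialUnitary (ι g)) {a b c a' b' c' : QuadraticAlgebra (ZMod p) d 0}
    (h : unitri a b c ∈ matrixImage ι H) (h' : unitri a' b' c' ∈ matrixImage ι H)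
    (hne : a.re * a'.im - a.im * a'.re ≠ 0) {x y : QuadraticAlgebra (ZMod p) d 0}
    (hxy : y + star y + x * star x = 0) : unitri x y (-star x) ∈ matrixImage ι H := by
  have hu {M} (hM : M ∈ matrixImage ι H) : IsSpecialUnitary M := by
    obtain ⟨g, -, rfl⟩ := hM
    exact hι g
  let Z : AddSubgroup (QuadraticAlgebra (ZMod p) d 0) :=
    { carrier := {y | unitri 0 y 0 ∈ matrixImage ι H}
      zero_mem' := by
        rw [Set.mem_ofPred_eq, unitri_zero]
        exact one_mem _
      add_mem' {y y'} hy hy' := by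
        have e := mul_mem (Set.mem_ofPred_eq ▸ hy) (Set.mem_ofPred_eq ▸ hy')
        rw [unitri_mul] at e
        simpa using e
      neg_mem' {y} hy := by
        have e := unitri_neg_mem hy
        simpa using e }
  have hZ (y : QuadraticAlgebra (ZMod p) d 0) (hy : y.re = 0) :
      unitri 0 y 0 ∈ matrixImage ι H := by
    obtain ⟨q, hd⟩ : ∃ q, 2 * (a.re * a'.im - a.im * a'.re) * q = 1 :=
      ⟨_, mul_inv_cancel₀ (mul_ne_zero h2 hne)⟩
    have e := (AddSubgroup.toZModSubmodule p Z).smul_mem (y.im * q) (unitri_commutator_mem h h')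
    -- Here `c = -ā` and `c' = -ā'`, so `ac' - a'c` is purely imaginary with imaginary part `2(a.re
    -- a'.im - a.im a'.re)`.
    have e' : (y.im * q) • (a * c' - a' * c) = y := by
      rw [(isSpecialUnitary_unitri_iff.1 (hu h)).1, (isSpecialUnitary_unitri_iff.1 (hu h')).1]
      ext
      · simp [hy]
        ring
      · simp
        linear_combination y.im * hd
    rw [e'] at e
    exact e
  let P : AddSubgroup (QuadraticAlgebra (ZMod p) d 0) :=
    { carrier := {x | ∃ y z, unitri x y z ∈ matrixImage ι H}
      zero_mem' := ⟨0, 0, hZ 0 rfl⟩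
      add_mem' := by
        rintro x x' ⟨y, z, hy⟩ ⟨y', z', hy'⟩
        have e := mul_mem hy hy'
        rw [unitri_mul] at e
        exact ⟨_, _, e⟩
      neg_mem' := by
        rintro x ⟨y, z, hy⟩
        exact ⟨_, _, unitri_neg_mem hy⟩ }
  have hP : x ∈ AddSubgroup.toZModSubmodule p P := by
    have hd := mul_inv_cancel₀ hne
    have e := add_mem
      ((AddSubgroup.toZModSubmodule p P).smul_mem
        ((x.re * a'.im - x.im * a'.re) * (a.re * a'.im - a.im * a'.re)⁻¹)
        (show a ∈ AddSubgroup.toZModSubmodule p P from ⟨b, c, h⟩))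
      ((AddSubgroup.toZModSubmodule p P).smul_mem
        ((x.im * a.re - x.re * a.im) * (a.re * a'.im - a.im * a'.re)⁻¹)
        (show a' ∈ AddSubgroup.toZModSubmodule p P from ⟨b', c', h'⟩))
    convert e using 1
    ext
    · simp only [QuadraticAlgebra.re_add, QuadraticAlgebra.re_smul, smul_eq_mul]
      linear_combination -x.re * hd
    · simp only [QuadraticAlgebra.im_add, QuadraticAlgebra.im_smul, smul_eq_mul]
      linear_combination -x.im * hd
  obtain ⟨y', z', hy'⟩ := hP
  obtain ⟨rfl, hxy'⟩ := isSpecialUnitary_unitri_iff.1 (hu hy')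
  have hre : (y - y').re = 0 := by
    have e : (y - y') + star (y - y') = 0 := by
      rw [star_sub]
      linear_combination hxy - hxy'
    have e' := congrArg QuadraticAlgebra.re e
    simp only [QuadraticAlgebra.re_add, QuadraticAlgebra.re_star, zero_mul, add_zero,
      QuadraticAlgebra.re_zero] at e'
    refine (mul_eq_zero.1 (?_ : 2 * (y - y').re = 0)).resolve_left h2
    linear_combination e'
  have e := mul_mem hy' (hZ (y - y') hre)
  rw [unitri_mul] at e
  simpa using e

theorem mem_matrixImage_of_mul_mem {M N : Matrix (Fin 3) (Fin 3) (QuadraticAlgebra (ZMod p) d 0)}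
    (hM : M ∈ matrixImage ι H) (h : M * N ∈ matrixImage ι H) : N ∈ matrixImage ι H := by
  obtain ⟨g, hg, rfl⟩ := hM
  have e : ι g⁻¹ * (ι g * N) ∈ matrixImage ι H := mul_mem ⟨g⁻¹, H.inv_mem hg, rfl⟩ h
  rwa [← mul_assoc, ← map_mul, inv_mul_cancel, map_one, one_mul] at e

/-- Elimination on the first column by unitriangular unitary matrices. Isotropy of that column is
exactly what makes the required clearing matrices unitary; once the column is `(1, 0, 0)`, the
matrix is itself unitriangular. -/
theorem eq_top_of_unitri_mem_of_isSpecialUnitary (h2 : (2 : ZMod p) ≠ 0)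
    (hnorm : ∀ s : ZMod p, ∃ x y, x * x - d * (y * y) = s) (hinj : Function.Injective ι)
    (hι : ∀ g, IsSpecialUnitary (ι g))
    (hJ : negAntidiag (QuadraticAlgebra (ZMod p) d 0) ∈ matrixImage ι H)
    {a b c a' b' c' : QuadraticAlgebra (ZMod p) d 0}
    (h : unitri a b c ∈ matrixImage ι H) (h' : unitri a' b' c' ∈ matrixImage ι H)
    (hne : a.re * a'.im - a.im * a'.re ≠ 0) : H = ⊤ := by
  have hu {M} (hM : M ∈ matrixImage ι H) : IsSpecialUnitary M := by
    obtain ⟨g, -, rfl⟩ := hM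
    exact hι g
  have hU {x y} (hxy : y + star y + x * star x = 0) : unitri x y (-star x) ∈ matrixImage ι H :=
    unitri_mem_of_isSpecialUnitary h2 hι h h' hne hxy
  have hL {x y : QuadraticAlgebra (ZMod p) d 0} (hxy : y + star y + x * star x = 0) :
      !![1, 0, 0; -star x, 1, 0; y, x, 1] ∈ matrixImage ι H := by
    rw [← negAntidiag_mul_unitri]
    exact mul_mem (mul_mem hJ (hU hxy)) hJ
  have s0 {z : QuadraticAlgebra (ZMod p) d 0} : z * star z = 0 → z = 0 := fun h => by
    rcases mul_eq_zero.1 h with h | h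
    · exact h
    · exact star_eq_zero.1 h
  have step1 {M} (hM : IsSpecialUnitary M) (h0 : M 0 0 = 1) (h1 : M 1 0 = 0) (h3 : M 2 0 = 0) :
      M ∈ matrixImage ι H := by
    have r22 := hM.row 2 2
    have r02 := hM.row 0 2
    have r01 := hM.row 0 1
    have r00 := hM.row 0 0
    have hdet := hM.det
    simp [h0, h1, h3, negAntidiag] at r22 r02 r01 r00
    have h22 : M 2 2 = 1 := by
      have e : star (M 2 2) = 1 := by simpa [r22] using r02
      simpa using congrArg star e
    have h11 : M 1 1 = 1 := by simpa [det_fin_three, h0, h1, h3, r22, h22] using hdet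
    have h12 : M 1 2 = -star (M 0 1) := by
      have e : star (M 1 2) = -M 0 1 := by
        rw [h11] at r01
        simp at r01
        linear_combination r01
      simpa using congrArg star e
    have e : M = unitri (M 0 1) (M 0 2) (-star (M 0 1)) := by
      ext i j : 1
      fin_cases i <;> fin_cases j <;> simp [unitri, h0, h1, h3, r22, h22, h11, h12]
    rw [e]
    exact hU (by linear_combination r00)
  have step2 {M} (hM : IsSpecialUnitary M) (h0 : M 0 0 = 1) : M ∈ matrixImage ι H := by
    have hiso := hM.column_isotropic
    rw [h0, star_one] at hiso
    have hl := hL (x := star (M 1 0)) (y := -star (M 1 0) * M 1 0 - M 2 0) (by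
      simp only [star_sub, star_mul, star_neg, star_star]
      linear_combination -hiso)
    refine mem_matrixImage_of_mul_mem hl (step1 ((hu hl).mul hM) ?_ ?_ ?_) <;>
      simp [mul_apply, Fin.sum_univ_three, h0]
    ring
  have step3 {M} (hM : IsSpecialUnitary M) (h0 : M 0 0 = 0) (h1 : M 1 0 = 0) (h3 : M 2 0 ≠ 0) :
      M ∈ matrixImage ι H := by
    -- The corner entry has to be `y = (M 2 0)⁻¹` to make the top left entry `1`. Unitarity then
    -- asks for an `x` of norm `-(y + ȳ)`, so surjectivity of the norm is needed.
    obtain ⟨s, t, hst⟩ := hnorm (-((M 2 0)⁻¹ + star (M 2 0)⁻¹).re)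
    have hl := hU (x := ⟨s, t⟩) (y := (M 2 0)⁻¹) (by
      ext
      · simp at hst ⊢
        linear_combination hst
      · simp
        ring)
    refine mem_matrixImage_of_mul_mem hl (step2 ((hu hl).mul hM) ?_)
    simp [unitri, mul_apply, Fin.sum_univ_three, h0, h1, h3]
  have step4 {M} (hM : IsSpecialUnitary M) (h3 : M 2 0 ≠ 0) : M ∈ matrixImage ι H := by
    have hiso := hM.column_isotropic
    have h3' : star (M 2 0) ≠ 0 := star_ne_zero.2 h3
    have hl := hU (x := star (M 1 0) / star (M 2 0))
      (y := -(M 0 0 + star (M 1 0) / star (M 2 0) * M 1 0) / M 2 0) (by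
        simp only [star_div₀, star_neg, star_add, star_mul', star_star]
        field_simp
        linear_combination -hiso)
    refine mem_matrixImage_of_mul_mem hl (step3 ((hu hl).mul hM) ?_ ?_ ?_)
    · simp [unitri, mul_apply, Fin.sum_univ_three]
      field_simp
      ring
    · simp [unitri, mul_apply, Fin.sum_univ_three]
      field_simp
      ring
    · simpa [unitri, mul_apply, Fin.sum_univ_three] using h3
  have step5 {M} (hM : IsSpecialUnitary M) : M ∈ matrixImage ι H := by
    by_cases h3 : M 2 0 = 0
    · have hiso := hM.column_isotropic
      rw [h3, star_zero, mul_zero, zero_mul, zero_add, add_zero] at hiso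
      have h1 := s0 hiso
      have h0 : M 0 0 ≠ 0 := fun h0 => by
        have e := hM.det
        simp [det_fin_three, h0, h1, h3] at e
      -- With `M 2 0 = 0`, isotropy forces `M 1 0 = 0`, hence `M 0 0 ≠ 0`. Adding a trace-zero
      -- multiple of the top row to the bottom one makes the lower left entry non-zero.
      have hl := hL (x := 0) (y := ⟨0, 1⟩) (by ext <;> simp)
      refine mem_matrixImage_of_mul_mem hl (step4 ((hu hl).mul hM) ?_)
      have hw : (⟨0, 1⟩ : QuadraticAlgebra (ZMod p) d 0) ≠ 0 := fun e => by
        simpa using congrArg QuadraticAlgebra.im e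
      simpa [mul_apply, Fin.sum_univ_three, h1, h3] using ⟨hw, h0⟩
    · exact step4 hM h3
  exact eq_top_of_forall_mem_matrixImage hinj fun g => step5 (hι g)

end SpecialUnitary

/-! ### The algebra of self-adjoint traceless matrices. -/

section UnitaryModel

variable {p : ℕ} [Fact p.Prime] {d : ZMod p}

/-- Traceless matrices that are self-adjoint for the antidiagonal Hermitian form. -/
def selfAdjointTraceless (p : ℕ) [Fact p.Prime] (d : ZMod p) :
    Submodule (ZMod p) (Matrix (Fin 3) (Fin 3) (QuadraticAlgebra (ZMod p) d 0)) where
  carrier := {X | X.trace = 0 ∧ negAntidiag _ * Xᴴ * negAntidiag _ = X}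
  zero_mem' := by simp
  add_mem' := by
    rintro X Y ⟨hX, hX'⟩ ⟨hY, hY'⟩
    exact ⟨by rw [trace_add, hX, hY, add_zero],
      by rw [conjTranspose_add, mul_add, add_mul, hX', hY']⟩
  smul_mem' := by
    rintro r X ⟨hX, hX'⟩
    refine ⟨by rw [trace_smul, hX, smul_zero], ?_⟩
    have e : (r • X)ᴴ = r • Xᴴ := by
      ext i j <;> simp
    rw [e, mul_smul_comm, smul_mul_assoc, hX']

/-- This is why the trace form takes values in the prime field. -/
theorem star_trace_mul {X Y : Matrix (Fin 3) (Fin 3) (QuadraticAlgebra (ZMod p) d 0)}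
    (hX : X ∈ selfAdjointTraceless p d) (hY : Y ∈ selfAdjointTraceless p d) :
    star (X * Y).trace = (X * Y).trace := by
  have hN := negAntidiag_mul_self (QuadraticAlgebra (ZMod p) d 0)
  calc star (X * Y).trace = (Xᴴ * Yᴴ).trace := by
        rw [← trace_conjTranspose, conjTranspose_mul, trace_mul_comm]
    _ = (negAntidiag _ * (negAntidiag _ * (Xᴴ * Yᴴ))).trace := by
        rw [← Matrix.mul_assoc, hN, Matrix.one_mul]
    _ = (negAntidiag _ * Xᴴ * negAntidiag _ * (negAntidiag _ * Yᴴ * negAntidiag _)).trace := by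
        rw [trace_mul_comm]
        simp only [Matrix.mul_assoc]
        rw [← Matrix.mul_assoc (negAntidiag _) (negAntidiag _), hN, Matrix.one_mul]
    _ = (X * Y).trace := by rw [hX.2, hY.2]

theorem algebraMap_re_of_star_eq_self (h2 : (2 : ZMod p) ≠ 0) {z : QuadraticAlgebra (ZMod p) d 0}
    (hz : star z = z) : algebraMap (ZMod p) (QuadraticAlgebra (ZMod p) d 0) z.re = z := by
  ext
  · simp
  · have e := congrArg QuadraticAlgebra.im hz
    rw [QuadraticAlgebra.im_star] at e
    rw [QuadraticAlgebra.algebraMap_im]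
    refine ((mul_eq_zero.1 (?_ : 2 * z.im = 0)).resolve_left h2).symm
    linear_combination -e

theorem tracelessMul_mem_selfAdjointTraceless {h t : ZMod p} (hh : 2 * h = 1) (ht : 3 * t = 1)
    {X Y : Matrix (Fin 3) (Fin 3) (QuadraticAlgebra (ZMod p) d 0)}
    (hX : X ∈ selfAdjointTraceless p d) (hY : Y ∈ selfAdjointTraceless p d) :
    tracelessMul h t X Y ∈ selfAdjointTraceless p d := by
  refine ⟨trace_tracelessMul hh ht X Y, ?_⟩
  have hN := negAntidiag_mul_self (QuadraticAlgebra (ZMod p) d 0)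
  have hs (r : ZMod p) (Z : Matrix (Fin 3) (Fin 3) (QuadraticAlgebra (ZMod p) d 0)) :
      (r • Z)ᴴ = r • Zᴴ := by
    ext i j <;> simp
  have hm {X Y : Matrix (Fin 3) (Fin 3) (QuadraticAlgebra (ZMod p) d 0)}
      (hX : X ∈ selfAdjointTraceless p d) (hY : Y ∈ selfAdjointTraceless p d) :
      negAntidiag _ * (Yᴴ * Xᴴ) * negAntidiag _ = Y * X := by
    conv_rhs => rw [← hX.2, ← hY.2]
    simp only [Matrix.mul_assoc]
    rw [← Matrix.mul_assoc (negAntidiag _) (negAntidiag _), hN, Matrix.one_mul]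
  rw [tracelessMul, conjTranspose_sub, hs, hs, conjTranspose_add, conjTranspose_mul,
    conjTranspose_mul, conjTranspose_smul, conjTranspose_one, star_trace_mul hX hY]
  simp only [mul_sub, sub_mul, mul_add, add_mul, mul_smul_comm, smul_mul_assoc, hm hX hY,
    hm hY hX, mul_one, hN]
  rw [add_comm]

theorem apply_of_mem_selfAdjointTraceless
    {X : Matrix (Fin 3) (Fin 3) (QuadraticAlgebra (ZMod p) d 0)}
    (hX : X ∈ selfAdjointTraceless p d) (i j : Fin 3) : X i j = star (X (2 - j) (2 - i)) := by
  conv_lhs => rw [← hX.2]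
  rw [mul_apply]
  simp only [mul_apply, Fin.sum_univ_three]
  fin_cases i <;> fin_cases j <;> simp [negAntidiag]

/-- Self-adjoint traceless matrices over a quadratic extension. -/
def unitaryModel (p : ℕ) [Fact p.Prime] (d h t : ZMod p) (hh : 2 * h = 1) (ht : 3 * t = 1) :
    TracelessModel (ZMod p) (QuadraticAlgebra (ZMod p) d 0) where
  half := h
  third := t
  two_mul_half := hh
  three_mul_third := ht
  carrier := selfAdjointTraceless p d
  re := QuadraticAlgebra.reₗ d 0
  trace_eq_zero _ hX := hX.1
  mul_mem _ hX _ hY := tracelessMul_mem_selfAdjointTraceless hh ht hX hY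
  trace_mul _ hX _ hY := algebraMap_re_of_star_eq_self
    (fun h2 => by simp [h2] at hh) (star_trace_mul hX hY)
  -- Self-adjointness is conjugation combined with reflection in the antidiagonal. It fixes `X 0 2`
  -- and `X 2 0`, whose real parts therefore suffice; `X 1 1` follows from the trace.
  coord :=
    { toFun X := ![(X 0 0).re, (X 0 0).im, (X 0 1).re, (X 0 1).im, (X 1 0).re, (X 1 0).im,
        (X 0 2).re, (X 2 0).re]
      map_add' X Y := by simp
      map_smul' r X := by simp }
  coord_inj X hX h := by
    have h2 : (2 : ZMod p) ≠ 0 := fun h2 => by simp [h2] at hh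
    have k (i : Fin 8) := congrFun h i
    have ha := apply_of_mem_selfAdjointTraceless hX
    have k00 : X 0 0 = 0 := QuadraticAlgebra.ext (k 0) (k 1)
    have k01 : X 0 1 = 0 := QuadraticAlgebra.ext (k 2) (k 3)
    have k10 : X 1 0 = 0 := QuadraticAlgebra.ext (k 4) (k 5)
    have k22 : X 2 2 = 0 := (ha 2 2).trans (star_eq_zero.2 k00)
    have k12 : X 1 2 = 0 := (ha 1 2).trans (star_eq_zero.2 k01)
    have k21 : X 2 1 = 0 := (ha 2 1).trans (star_eq_zero.2 k10)
    have k02 : X 0 2 = 0 := by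
      have s02 : star (X 0 2) = X 0 2 := (ha 0 2).symm
      exact (algebraMap_re_of_star_eq_self h2 s02).symm.trans (QuadraticAlgebra.ext (k 6) rfl)
    have k20 : X 2 0 = 0 := by
      have s20 : star (X 2 0) = X 2 0 := (ha 2 0).symm
      exact (algebraMap_re_of_star_eq_self h2 s20).symm.trans (QuadraticAlgebra.ext (k 7) rfl)
    have k11 : X 1 1 = 0 := by simpa [trace_fin_three, k00, k22] using hX.1
    ext i j : 1
    fin_cases i <;> fin_cases j <;> assumption

theorem conj_mem_selfAdjointTraceless {g g' X : Matrix (Fin 3) (Fin 3) (QuadraticAlgebra (ZMod p) d 0)}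
    (hg : g * negAntidiag _ * gᴴ = negAntidiag _) (hg' : g' * negAntidiag _ * g'ᴴ = negAntidiag _)
    (h : g' * g = 1) (hX : X ∈ selfAdjointTraceless p d) :
    g * X * g' ∈ selfAdjointTraceless p d := by
  have h' := mul_eq_one_comm.1 h
  have hN := negAntidiag_mul_self (QuadraticAlgebra (ZMod p) d 0)
  refine ⟨by rw [trace_mul_comm, ← Matrix.mul_assoc, h, Matrix.one_mul, hX.1], ?_⟩
  have e1 : negAntidiag _ * g'ᴴ = g * negAntidiag _ := by
    rw [← Matrix.one_mul (negAntidiag _ * g'ᴴ), ← h', Matrix.mul_assoc g,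
      ← Matrix.mul_assoc g' (negAntidiag _), hg']
  have e2 : gᴴ * negAntidiag _ = negAntidiag _ * g' := by
    have e : negAntidiag _ * gᴴ = g' * negAntidiag _ := by
      rw [← Matrix.one_mul (negAntidiag _ * gᴴ), ← h, Matrix.mul_assoc g',
        ← Matrix.mul_assoc g (negAntidiag _), hg]
    calc gᴴ * negAntidiag _ = negAntidiag _ * (negAntidiag _ * gᴴ) * negAntidiag _ := by
          rw [← Matrix.mul_assoc, hN, Matrix.one_mul]
      _ = negAntidiag _ * g' := by
          rw [e, Matrix.mul_assoc, Matrix.mul_assoc, hN, Matrix.mul_one]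
  calc negAntidiag _ * (g * X * g')ᴴ * negAntidiag _
      = (negAntidiag _ * g'ᴴ) * Xᴴ * (gᴴ * negAntidiag _) := by
        simp only [conjTranspose_mul, Matrix.mul_assoc]
    _ = g * (negAntidiag _ * Xᴴ * negAntidiag _) * g' := by
        rw [e1, e2]
        simp only [Matrix.mul_assoc]
    _ = g * X * g' := by rw [hX.2]

end UnitaryModel

/-! ### `SU(3, p)` over `GaloisField p 2`, and the unitary case. -/

section FiniteUnitary

variable {p : ℕ} [Fact p.Prime] {d : ZMod p} [Fact (∀ r : ZMod p, r ^ 2 ≠ d + 0 * r)]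

/-- Frobenius is additive, fixes the prime field and negates `√d`, which characterises conjugation.
-/
theorem star_eq_pow_of_omega_pow (hω : (⟨0, 1⟩ : QuadraticAlgebra (ZMod p) d 0) ^ p = ⟨0, -1⟩)
    (z : QuadraticAlgebra (ZMod p) d 0) : star z = z ^ p := by
  have : CharP (QuadraticAlgebra (ZMod p) d 0) p :=
    charP_of_injective_algebraMap (QuadraticAlgebra.algebraMap_injective) p
  have e : z = algebraMap (ZMod p) (QuadraticAlgebra (ZMod p) d 0) z.re +
      algebraMap (ZMod p) (QuadraticAlgebra (ZMod p) d 0) z.im * ⟨0, 1⟩ := by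
    ext <;> simp
  conv_rhs => rw [e, add_pow_char, mul_pow, hω, ← map_pow, ← map_pow, ZMod.pow_card, ZMod.pow_card]
  ext <;> simp

theorem nonempty_ringEquiv_galoisField (p : ℕ) [Fact p.Prime] (d : ZMod p)
    [Fact (∀ r : ZMod p, r ^ 2 ≠ d + 0 * r)] :
    Nonempty (GaloisField p 2 ≃+* QuadraticAlgebra (ZMod p) d 0) := by
  refine ⟨(GaloisField.algEquivGaloisField p 2 ?_).symm.toRingEquiv⟩
  rw [Nat.card_congr (QuadraticAlgebra.equivProd d 0), Nat.card_prod, Nat.card_zmod, sq]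

/-- Elements of the special unitary group as matrices preserving the antidiagonal form. -/
noncomputable def specialUnitaryCoe (θ : GaloisField p 2 ≃+* QuadraticAlgebra (ZMod p) d 0)
    {Q Q' : Matrix (Fin 3) (Fin 3) (QuadraticAlgebra (ZMod p) d 0)} (hQ : Q' * Q = 1)
    (hQ' : Q * Q' = 1) :
    finiteSU 3 p →* Matrix (Fin 3) (Fin 3) (QuadraticAlgebra (ZMod p) d 0) where
  toFun M := Q * θ.toRingHom.mapMatrix (M : SL(3, GaloisField p 2)).1 * Q'
  map_one' := by
    have e : ((1 : finiteSU 3 p) : SL(3, GaloisField p 2)).1 = 1 := rfl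
    rw [e, map_one, Matrix.mul_one, hQ']
  map_mul' M N := by
    have e : ((M * N : finiteSU 3 p) : SL(3, GaloisField p 2)).1 =
      (M : SL(3, GaloisField p 2)).1 * (N : SL(3, GaloisField p 2)).1 := rfl
    rw [e, map_mul]
    simp only [Matrix.mul_assoc]
    rw [← Matrix.mul_assoc Q' Q, hQ, Matrix.one_mul]

variable (θ : GaloisField p 2 ≃+* QuadraticAlgebra (ZMod p) d 0)
    {Q Q' : Matrix (Fin 3) (Fin 3) (QuadraticAlgebra (ZMod p) d 0)} (hQ : Q' * Q = 1)
    (hQ' : Q * Q' = 1)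

theorem specialUnitaryCoe_injective : Function.Injective (specialUnitaryCoe θ hQ hQ') := by
  intro M N h
  have e : Q' * (specialUnitaryCoe θ hQ hQ' M) * Q = Q' * (specialUnitaryCoe θ hQ hQ' N) * Q := by
    rw [h]
  have k (M : finiteSU 3 p) : Q' * (specialUnitaryCoe θ hQ hQ' M) * Q =
      θ.toRingHom.mapMatrix (M : SL(3, GaloisField p 2)).1 := by
    change Q' * (Q * θ.toRingHom.mapMatrix (M : SL(3, GaloisField p 2)).1 * Q') * Q = _
    simp only [Matrix.mul_assoc]
    rw [hQ, Matrix.mul_one, ← Matrix.mul_assoc, hQ, Matrix.one_mul]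
  rw [k, k] at e
  refine Subtype.ext (Subtype.ext (Matrix.ext fun i j => θ.injective ?_))
  exact congrFun (congrFun e i) j

theorem mapMatrix_frobenius (hω : (⟨0, 1⟩ : QuadraticAlgebra (ZMod p) d 0) ^ p = ⟨0, -1⟩)
    (M : SL(3, GaloisField p 2)) :
    θ.toRingHom.mapMatrix (frobeniusSL 3 p M).transpose.1 = (θ.toRingHom.mapMatrix M.1)ᴴ := by
  ext i j : 1
  change θ (M.1 j i ^ p) = star (θ (M.1 j i))
  rw [star_eq_pow_of_omega_pow hω, map_pow]

/-- The relation `Q Qᴴ = negAntidiag` carries the standard Hermitian form to the antidiagonal one,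
so conjugation by `Q` matches the two unitary groups. -/
theorem isSpecialUnitary_specialUnitaryCoe
    (hω : (⟨0, 1⟩ : QuadraticAlgebra (ZMod p) d 0) ^ p = ⟨0, -1⟩)
    (hQN : Q * Qᴴ = negAntidiag _) (M : finiteSU 3 p) :
    IsSpecialUnitary (specialUnitaryCoe θ hQ hQ' M) := by
  have hM : (M : SL(3, GaloisField p 2)).1 * (frobeniusSL 3 p M.1).transpose.1 = 1 :=
    congrArg Subtype.val M.2
  have e := congrArg θ.toRingHom.mapMatrix hM
  rw [map_mul, mapMatrix_frobenius θ hω, map_one] at e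
  have hdet : (θ.toRingHom.mapMatrix (M : SL(3, GaloisField p 2)).1).det = 1 := by
    rw [← RingHom.map_det, M.1.2, map_one]
  change IsSpecialUnitary (Q * θ.toRingHom.mapMatrix (M : SL(3, GaloisField p 2)).1 * Q')
  generalize θ.toRingHom.mapMatrix (M : SL(3, GaloisField p 2)).1 = X at *
  constructor
  · rw [det_mul, det_mul, hdet, mul_one, ← det_mul, hQ', det_one]
  · rw [← hQN]
    simp only [conjTranspose_mul, Matrix.mul_assoc]
    rw [← Matrix.mul_assoc Q' Q, hQ, Matrix.one_mul, ← Matrix.mul_assoc Qᴴ Q'ᴴ,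
      ← conjTranspose_mul, hQ, conjTranspose_one, Matrix.one_mul, ← Matrix.mul_assoc X, e,
      Matrix.one_mul]

theorem exists_specialUnitaryCoe_eq
    (hω : (⟨0, 1⟩ : QuadraticAlgebra (ZMod p) d 0) ^ p = ⟨0, -1⟩)
    (hQN : Q * Qᴴ = negAntidiag _) {R : Matrix (Fin 3) (Fin 3) (QuadraticAlgebra (ZMod p) d 0)}
    (hR : IsSpecialUnitary R) : ∃ M, specialUnitaryCoe θ hQ hQ' M = R := by
  let Y := θ.symm.toRingHom.mapMatrix (Q' * R * Q)
  have hY : θ.toRingHom.mapMatrix Y = Q' * R * Q := by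
    ext i j : 1
    exact θ.apply_symm_apply _
  have hinj : Function.Injective (θ.toRingHom.mapMatrix (m := Fin 3)) := by
    intro A B h
    ext i j
    exact θ.injective (congrFun (congrFun h i) j)
  have hdet : Y.det = 1 := by
    have e : θ.toRingHom Y.det = 1 := by
      rw [RingHom.map_det, hY, det_mul, det_mul, hR.det, mul_one, ← det_mul, hQ, det_one]
    exact θ.injective (e.trans (map_one θ).symm)
  let M : SL(3, GaloisField p 2) := ⟨Y, hdet⟩
  have hM : M ∈ finiteSU 3 p := by
    refine Subtype.ext (hinj ?_)
    change θ.toRingHom.mapMatrix (Y * (frobeniusSL 3 p M).transpose.1) = _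
    rw [map_mul, mapMatrix_frobenius θ hω]
    change θ.toRingHom.mapMatrix Y * (θ.toRingHom.mapMatrix Y)ᴴ = θ.toRingHom.mapMatrix 1
    rw [hY, map_one]
    calc Q' * R * Q * (Q' * R * Q)ᴴ = Q' * (R * (Q * Qᴴ) * Rᴴ) * Q'ᴴ := by
          simp only [conjTranspose_mul, Matrix.mul_assoc]
      _ = Q' * Q * (Q' * Q)ᴴ := by
          rw [hQN, hR.unitary, ← hQN]
          simp only [conjTranspose_mul, Matrix.mul_assoc]
      _ = 1 := by rw [hQ, conjTranspose_one, Matrix.one_mul]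
  refine ⟨⟨M, hM⟩, ?_⟩
  change Q * θ.toRingHom.mapMatrix Y * Q' = R
  rw [hY]
  simp only [Matrix.mul_assoc]
  rw [hQ', Matrix.mul_one, ← Matrix.mul_assoc, hQ', Matrix.one_mul]

end FiniteUnitary

/-- The finite data of the split case, together with a non-square `d`, surjectivity of the norm, the
action of Frobenius on `√d`, and a change of basis `Q` between the two Hermitian forms. -/
theorem universalMiyamotoGroupIso_PSU {p : ℕ} [Fact p.Prime] {d α β γ ψ h t : ZMod p}
    (hd : ∀ r : ZMod p, r ^ 2 ≠ d + 0 * r)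
    (hh : 2 * h = 1) (ht : 3 * t = 1) (va wa vb wb vc wc : Fin 3 → QuadraticAlgebra (ZMod p) d 0)
    (ha : wa ⬝ᵥ va = 1) (hb : wb ⬝ᵥ vb = 1) (hc : wc ⬝ᵥ vc = 1)
    (ha' : negAntidiag _ * (axisMatrix va wa)ᴴ * negAntidiag _ = axisMatrix va wa)
    (hb' : negAntidiag _ * (axisMatrix vb wb)ᴴ * negAntidiag _ = axisMatrix vb wb)
    (hc' : negAntidiag _ * (axisMatrix vc wc)ᴴ * negAntidiag _ = axisMatrix vc wc)
    (ra : reflectionMatrix va wa * negAntidiag _ * (reflectionMatrix va wa)ᴴ = negAntidiag _)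
    (rb : reflectionMatrix vb wb * negAntidiag _ * (reflectionMatrix vb wb)ᴴ = negAntidiag _)
    (rc : reflectionMatrix vc wc * negAntidiag _ * (reflectionMatrix vc wc)ᴴ = negAntidiag _)
    (hα : h * t * (axisMatrix va wa * axisMatrix vb wb).trace.re = α)
    (hβ : h * t * (axisMatrix vb wb * axisMatrix vc wc).trace.re = β)
    (hγ : h * t * (axisMatrix va wa * axisMatrix vc wc).trace.re = γ)
    (hψ : h * t * (axisMatrix vb wb *
      tracelessMul h t (axisMatrix va wa) (axisMatrix vc wc)).trace.re = ψ)
    (hJ : reflectionMatrix va wa = negAntidiag _)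
    (l l' : List (Fin 3)) (x y z x' y' z' : QuadraticAlgebra (ZMod p) d 0)
    (hl : (l.map ![reflectionMatrix va wa, reflectionMatrix vb wb,
      reflectionMatrix vc wc]).prod = unitri x y z)
    (hl' : (l'.map ![reflectionMatrix va wa, reflectionMatrix vb wb,
      reflectionMatrix vc wc]).prod = unitri x' y' z')
    (hne : x.re * x'.im - x.im * x'.re ≠ 0)
    (hnorm : ∀ s : ZMod p, ∃ x y, x * x - d * (y * y) = s)
    (hω : (⟨0, 1⟩ : QuadraticAlgebra (ZMod p) d 0) ^ p = ⟨0, -1⟩)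
    (Q Q' : Matrix (Fin 3) (Fin 3) (QuadraticAlgebra (ZMod p) d 0)) (hQ : Q' * Q = 1)
    (hQ' : Q * Q' = 1) (hQN : Q * Qᴴ = negAntidiag _) (D : Matrix (Fin 8) (Fin 8) (ZMod p))
    (hD : D * Matrix.of (fun i => (unitaryModel p d h t hh ht).coord
      (TracelessModel.matrixFamily h t (axisMatrix va wa) (axisMatrix vb wb) (axisMatrix vc wc) i)) = 1) :
    UniversalMiyamotoGroupIso.{u} (ZMod p) α β γ ψ (finitePSU 3 p) := by
  have : Fact (∀ r : ZMod p, r ^ 2 ≠ d + 0 * r) := ⟨hd⟩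
  let M := unitaryModel p d h t hh ht
  obtain ⟨θ⟩ := nonempty_ringEquiv_galoisField p d
  let ι := specialUnitaryCoe θ hQ hQ'
  have hι (g) : IsSpecialUnitary (ι g) := isSpecialUnitary_specialUnitaryCoe θ hQ hQ' hω hQN g
  obtain ⟨ga, ea⟩ := exists_specialUnitaryCoe_eq θ hQ hQ' hω hQN ⟨det_reflectionMatrix ha, ra⟩
  obtain ⟨gb, eb⟩ := exists_specialUnitaryCoe_eq θ hQ hQ' hω hQN ⟨det_reflectionMatrix hb, rb⟩
  obtain ⟨gc, ec⟩ := exists_specialUnitaryCoe_eq θ hQ hQ' hω hQN ⟨det_reflectionMatrix hc, rc⟩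
  have hr (i) : ι (![ga, gb, gc] i) =
      ![reflectionMatrix va wa, reflectionMatrix vb wb, reflectionMatrix vc wc] i := by
    fin_cases i <;> assumption
  have hG : Subgroup.closure {ga, gb, gc} = ⊤ := by
    refine eq_top_of_unitri_mem_of_isSpecialUnitary (fun h2 => by simp [h2] at hh) hnorm
      (specialUnitaryCoe_injective θ hQ hQ') hι ?_ (hl ▸ list_prod_mem_matrixImage_closure hr l)
      (hl' ▸ list_prod_mem_matrixImage_closure hr l') hne
    exact ⟨ga, Subgroup.subset_closure (by simp), ea.trans hJ⟩
  have key := M.universalMiyamotoGroupIso.{u} ⟨_, trace_axisMatrix ha, ha'⟩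
    ⟨_, trace_axisMatrix hb, hb'⟩ ⟨_, trace_axisMatrix hc, hc'⟩ ι
    (fun g X hX => conj_mem_selfAdjointTraceless (hι g).unitary (hι g⁻¹).unitary
      (by rw [← map_mul, inv_mul_cancel, map_one]) hX)
    (specialUnitaryCoe_injective θ hQ hQ') hG ha hb hc ea eb ec rfl rfl rfl D hD
  subst hα hβ hγ hψ
  exact key

theorem universalMiyamotoGroupIso_PSU_seven :
    UniversalMiyamotoGroupIso.{u} (ZMod 7) 6 2 1 1 (finitePSU 3 7) :=
  universalMiyamotoGroupIso_PSU (d := 6) (h := 4) (t := 5) (by decide +kernel) (by decide +kernel) (by decide +kernel)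
    ![⟨1, 0⟩, ⟨0, 0⟩, ⟨6, 0⟩] ![⟨4, 0⟩, ⟨0, 0⟩, ⟨3, 0⟩]
    -- Up to a scalar, `w` is the conjugate of `v` read backwards, so `v wᵀ` is an orthogonal
    -- projection for the antidiagonal form.
    ![⟨2, 3⟩, ⟨1, 3⟩, ⟨6, 0⟩] ![⟨1, 0⟩, ⟨6, 3⟩, ⟨5, 3⟩]
    ![⟨1, 4⟩, ⟨1, 1⟩, ⟨5, 0⟩] ![⟨1, 0⟩, ⟨3, 4⟩, ⟨3, 2⟩]
    (by decide +kernel) (by decide +kernel) (by decide +kernel) (by decide +kernel) (by decide +kernel)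
    (by decide +kernel) (by decide +kernel) (by decide +kernel) (by decide +kernel) (by decide +kernel)
    (by decide +kernel) (by decide +kernel) (by decide +kernel) (by decide +kernel)
    [1, 2, 1, 0, 2, 1, 0, 2, 1, 2, 1, 2, 0, 1, 2, 0]
    [1, 2, 1, 2, 0, 1, 2, 0, 1, 2, 1, 0, 2, 1, 0, 2]
    ⟨0, 6⟩ ⟨3, 6⟩ ⟨0, 6⟩ ⟨2, 1⟩ ⟨1, 3⟩ ⟨5, 1⟩
    (by decide +kernel) (by decide +kernel) (by decide +kernel) (by decide +kernel) (by decide +kernel)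
    -- With `z` of norm `-1`, the rows of `Q` are `(1, 0, z)`, `(0, z, 0)` and `(-1/2, 0, z/2)`; the
    -- outer two are isotropic for the standard form. The other primes use the same shape.
    !![⟨1, 0⟩, ⟨0, 0⟩, ⟨2, 3⟩;
      ⟨0, 0⟩, ⟨2, 3⟩, ⟨0, 0⟩;
      ⟨3, 0⟩, ⟨0, 0⟩, ⟨1, 5⟩]
    !![⟨4, 0⟩, ⟨0, 0⟩, ⟨6, 0⟩;
      ⟨0, 0⟩, ⟨5, 3⟩, ⟨0, 0⟩;
      ⟨6, 5⟩, ⟨0, 0⟩, ⟨5, 3⟩]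
    (by decide +kernel) (by decide +kernel) (by decide +kernel)
    !![4, 0, 2, 0, 5, 3, 4, 0;
      1, 0, 6, 4, 0, 4, 3, 6;
      4, 0, 6, 1, 4, 3, 1, 6;
      5, 1, 4, 2, 5, 4, 4, 3;
      1, 2, 4, 2, 0, 5, 5, 1;
      0, 5, 0, 1, 1, 5, 5, 3;
      6, 3, 3, 1, 5, 3, 1, 4;
      4, 4, 0, 6, 6, 5, 5, 3]
    (by decide +kernel)

theorem universalMiyamotoGroupIso_PSU_eleven :
    UniversalMiyamotoGroupIso.{u} (ZMod 11) 1 1 3 1 (finitePSU 3 11) :=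
  universalMiyamotoGroupIso_PSU (d := 10) (h := 6) (t := 4) (by decide +kernel) (by decide +kernel) (by decide +kernel)
    ![⟨1, 0⟩, ⟨0, 0⟩, ⟨10, 0⟩] ![⟨6, 0⟩, ⟨0, 0⟩, ⟨5, 0⟩]
    ![⟨5, 3⟩, ⟨0, 9⟩, ⟨2, 0⟩] ![⟨1, 0⟩, ⟨0, 1⟩, ⟨8, 4⟩]
    ![⟨1, 10⟩, ⟨6, 10⟩, ⟨7, 0⟩] ![⟨1, 0⟩, ⟨4, 8⟩, ⟨8, 8⟩]
    (by decide +kernel) (by decide +kernel) (by decide +kernel) (by decide +kernel) (by decide +kernel)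
    (by decide +kernel) (by decide +kernel) (by decide +kernel) (by decide +kernel) (by decide +kernel)
    (by decide +kernel) (by decide +kernel) (by decide +kernel) (by decide +kernel)
    [2, 1, 0, 1, 0, 1, 0, 1, 2, 0, 2, 1, 0, 1, 2, 0]
    [2, 0, 2, 0, 1, 2, 1, 0, 2, 0, 1, 2, 1, 2, 1, 2, 1, 2]
    ⟨6, 9⟩ ⟨2, 0⟩ ⟨5, 9⟩ ⟨8, 3⟩ ⟨2, 5⟩ ⟨3, 3⟩
    (by decide +kernel) (by decide +kernel) (by decide +kernel) (by decide +kernel) (by decide +kernel)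
    !![⟨1, 0⟩, ⟨0, 0⟩, ⟨1, 3⟩;
      ⟨0, 0⟩, ⟨1, 3⟩, ⟨0, 0⟩;
      ⟨5, 0⟩, ⟨0, 0⟩, ⟨6, 7⟩]
    !![⟨6, 0⟩, ⟨0, 0⟩, ⟨10, 0⟩;
      ⟨0, 0⟩, ⟨10, 3⟩, ⟨0, 0⟩;
      ⟨5, 7⟩, ⟨0, 0⟩, ⟨10, 3⟩]
    (by decide +kernel) (by decide +kernel) (by decide +kernel)
    !![1, 10, 0, 2, 7, 0, 8, 0;
      3, 6, 7, 5, 6, 8, 10, 8;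
      0, 2, 9, 6, 6, 3, 1, 5;
      3, 1, 9, 9, 4, 8, 1, 10;
      6, 5, 0, 2, 10, 1, 0, 6;
      3, 9, 2, 4, 6, 0, 8, 10;
      0, 9, 5, 9, 7, 0, 0, 4;
      7, 9, 6, 10, 10, 0, 10, 7]
    (by decide +kernel)

theorem universalMiyamotoGroupIso_PSU_thirteen :
    UniversalMiyamotoGroupIso.{u} (ZMod 13) 8 10 4 1 (finitePSU 3 13) :=
  universalMiyamotoGroupIso_PSU (d := 2) (h := 7) (t := 9) (by decide +kernel) (by decide +kernel) (by decide +kernel)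
    ![⟨1, 0⟩, ⟨0, 0⟩, ⟨12, 0⟩] ![⟨7, 0⟩, ⟨0, 0⟩, ⟨6, 0⟩]
    ![⟨12, 4⟩, ⟨0, 5⟩, ⟨5, 0⟩] ![⟨1, 0⟩, ⟨0, 12⟩, ⟨5, 7⟩]
    ![⟨9, 10⟩, ⟨12, 9⟩, ⟨11, 0⟩] ![⟨1, 0⟩, ⟨7, 11⟩, ⟨2, 5⟩]
    (by decide +kernel) (by decide +kernel) (by decide +kernel) (by decide +kernel) (by decide +kernel)
    (by decide +kernel) (by decide +kernel) (by decide +kernel) (by decide +kernel) (by decide +kernel)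
    (by decide +kernel) (by decide +kernel) (by decide +kernel) (by decide +kernel)
    [2, 1, 0, 1, 2, 0, 1, 2, 0, 2, 1, 0, 2, 1, 0, 1, 2, 0, 1, 2, 0, 2, 1, 0]
    [0, 1, 2, 0, 2, 0, 2, 0, 2, 1, 2, 1, 2, 0, 2, 1, 2, 1, 2, 0, 2, 0, 1, 0]
    ⟨4, 5⟩ ⟨4, 11⟩ ⟨9, 5⟩ ⟨5, 7⟩ ⟨4, 3⟩ ⟨8, 7⟩
    (by decide +kernel) (by decide +kernel) (by decide +kernel) (by decide +kernel) (by decide +kernel)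
    !![⟨1, 0⟩, ⟨0, 0⟩, ⟨1, 1⟩;
      ⟨0, 0⟩, ⟨1, 1⟩, ⟨0, 0⟩;
      ⟨6, 0⟩, ⟨0, 0⟩, ⟨7, 7⟩]
    !![⟨7, 0⟩, ⟨0, 0⟩, ⟨12, 0⟩;
      ⟨0, 0⟩, ⟨12, 1⟩, ⟨0, 0⟩;
      ⟨6, 7⟩, ⟨0, 0⟩, ⟨12, 1⟩]
    (by decide +kernel) (by decide +kernel) (by decide +kernel)
    !![12, 2, 6, 9, 4, 1, 5, 0;
      0, 5, 1, 5, 8, 1, 8, 0;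
      11, 7, 8, 8, 11, 11, 7, 12;
      4, 12, 2, 2, 8, 8, 7, 6;
      0, 11, 8, 8, 0, 9, 10, 1;
      5, 9, 10, 8, 1, 5, 8, 6;
      4, 5, 12, 11, 1, 6, 7, 3;
      8, 0, 3, 5, 9, 3, 12, 10]
    (by decide +kernel)

theorem mainTheorem10 :
    (UniversalMiyamotoGroupIso.{u} (ZMod 7) 6 2 1 5 PSL(3, ZMod 7) ∧
      UniversalMiyamotoGroupIso.{u} (ZMod 11) 1 1 3 0 PSL(3, ZMod 11) ∧
      UniversalMiyamotoGroupIso.{u} (ZMod 13) 8 10 4 2 PSL(3, ZMod 13)) ∧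
    (UniversalMiyamotoGroupIso.{u} (ZMod 7) 6 2 1 1 (finitePSU 3 7) ∧
      UniversalMiyamotoGroupIso.{u} (ZMod 11) 1 1 3 1 (finitePSU 3 11) ∧
      UniversalMiyamotoGroupIso.{u} (ZMod 13) 8 10 4 1 (finitePSU 3 13)) :=
  ⟨⟨universalMiyamotoGroupIso_PSL_seven, universalMiyamotoGroupIso_PSL_eleven,
    universalMiyamotoGroupIso_PSL_thirteen⟩,
    universalMiyamotoGroupIso_PSU_seven, universalMiyamotoGroupIso_PSU_eleven,
    universalMiyamotoGroupIso_PSU_thirteen⟩
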